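/- Let $k$ be an algebraically closed field of characteristic $0$ and $G=\mathrm{PGL}_3(k)$. Let $\overline G$ be its wonderful compactification, i.e. the Zariski closure of the image of $[g]\mapsto([g],[\mathrm{Com}(g)])$ in $\mathbb P(M_3(k))\times\mathbb P(M_3(k))$, where $\mathrm{Com}(g)$ is the matrix of cofactors; write $([g],[g'])$ for its points. Let $\mathcal D$ be the sheaf of differential operators on $\overline G$: an endomorphism of $\mathcal O_U$ has order $\le 0$ if it is multiplication by a regular function, and order $\le n+1$ if on every open $V\subseteq U$ its commutator with every $a\in\mathcal O(V)$ has order $\le n$. On the big cell $(\overline G)_0=\{g_{33}g'_{11}\neq 0\}$ consider the eight regular functions $$\alpha_1=\frac{g'_{11}g'_{22}-g'_{12}g'_{21}}{g'^{\,2}_{11}},\quad \alpha_2=\frac{g_{22}g_{33}-g_{23}g_{32}}{g_{33}^2},\quad U_{12}=-\frac{g'_{21}}{g'_{11}},\quad U_{21}=-\frac{g'_{12}}{g'_{11}},\quad U_{i3}=\frac{g_{i3}}{g_{33}},\quad U_{3i}=\frac{g_{3i}}{g_{33}}\quad(i=1,2).$$ For each of these coordinates $c$ there is a unique derivation $\partial_c$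 of the structure sheaf of $(\overline G)_0$ which sends $c$ to $1$ and the seven other coordinates to $0$. The operator $D_0=\partial_{\alpha_1}\partial_{\alpha_2}$ on $(\overline G)_0$ extends, uniquely, to an endomorphism of the sheaf $\mathcal O_{\overline G}$; this extension, still denoted $D_0$, is a global differential operator on $\overline G$, of order $\le 2$ and not of order $\le 1$. When regular functions are written as rational functions of the entries $g_{ij}$ of a matrix $g$ representing a point of $G$, it is given by $$D_0=\partial_{g_{11}}\bigl(\Delta_{22}\partial_{g_{11}}+\Delta_{11}\partial_{g_{22}}+\Delta_{21}\partial_{g_{12}}+\Delta_{12}\partial_{g_{21}}\bigr),$$ where $\Delta_{ij}$ is the minor of $g$ obtained by deleting row $i$ and column $j$. Moreover, with $\mathfrak g=\mathfrak{sl}_3$, the operator $D_0$ is not the image of any element of $U(\mathfrak g\times\mathfrak g)$ under the morphism $U(\mathfrak g\times\mathfrak g)\to\mathcal D(\overline G)$ induced by the action of $G\times G$ on $\overline G$ by left and right multiplication. -/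

import Mathlib

open MvPolynomial TopologicalSpace
open scoped LinearAlgebra.Projectivization MatrixGroups

noncomputable section

namespace WonderfulPGL3

/-! ### The Zariski topology on `ℙ(M₃(k)) × ℙ(M₃(k))` -/

/-- `3 × 3` matrices. -/
abbrev Mat (k : Type*) := Matrix (Fin 3) (Fin 3) k

/-- The set of points of `ℙ(M₃(k)) × ℙ(M₃(k))`. It is a type of its own, so that the only topology
it carries is the Zariski topology below. -/
def BiProj (k : Type*) [Field k] : Type _ := ℙ k (Mat k) × ℙ k (Mat k)

/-- Indices of the `9 + 9` homogeneous coordinates: `Sum.inl (i, j)` is the coordinate `g i j` of the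
first matrix, `Sum.inr (i, j)` the coordinate `g' i j` of the second one. -/
abbrev BiIdx := (Fin 3 × Fin 3) ⊕ (Fin 3 × Fin 3)

/-- Bihomogeneous polynomials of bidegree `d` in the coordinates `g i j` and `g' i j`. -/
def IsBihom {k : Type*} [Field k] (F : MvPolynomial BiIdx k) (d : ℕ × ℕ) : Prop :=
  IsWeightedHomogeneous (Sum.elim (fun _ => (1, 0)) (fun _ => (0, 1)) : BiIdx → ℕ × ℕ) F d

section Topology

variable {k : Type*} [Field k]

/-- The value of a polynomial in `g i j`, `g' i j` at the chosen representatives of a point. Whether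
it vanishes (for bihomogeneous polynomials), and the ratio of two such values (for the same
bidegree), do not depend on the representatives. -/
def BiProj.evalAt (x : BiProj k) (F : MvPolynomial BiIdx k) : k :=
  eval (Sum.elim (fun p => x.1.rep p.1 p.2) (fun p => x.2.rep p.1 p.2)) F

/-- The Zariski topology: the sets `{F ≠ 0}` with `F` bihomogeneous form a basis. -/
instance : TopologicalSpace (BiProj k) :=
  TopologicalSpace.generateFrom
    {U | ∃ (d : ℕ × ℕ) (F : MvPolynomial BiIdx k), IsBihom F d ∧ U = {x | x.evalAt F ≠ 0}}

end Topology

/-! ### The wonderful compactification -/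

section Compactification

variable {k : Type*} [Field k]

/-- The matrix of cofactors (with signs) of `g`. -/
def comatrix (g : Mat k) : Mat k := g.adjugate.transpose

theorem gl_ne_zero (g : GL (Fin 3) k) : (g : Mat k) ≠ 0 := g.ne_zero

theorem comatrix_gl_ne_zero (g : GL (Fin 3) k) : comatrix (g : Mat k) ≠ 0 := by
  intro h
  have h1 : (g : Mat k).adjugate = 0 := by
    have := congrArg Matrix.transpose h
    simpa [comatrix] using this
  have h2 := Matrix.mul_adjugate (g : Mat k)
  rw [h1, mul_zero] at h2
  have h3 := congrFun (congrFun h2 0) 0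
  have h4 : (g : Mat k).det ≠ 0 := by
    have := (Matrix.isUnit_iff_isUnit_det (g : Mat k)).1 g.isUnit
    exact this.ne_zero
  simp at h3
  exact h4 h3.symm

theorem comatrix_smul (t : k) (g : Mat k) : comatrix (t • g) = t ^ 2 • comatrix g := by
  simp [comatrix, Matrix.adjugate_smul]

/-- The map `g ↦ ([g], [Com g])` on invertible matrices. -/
def embedGL (g : GL (Fin 3) k) : BiProj k :=
  (Projectivization.mk k (g : Mat k) (gl_ne_zero g),
    Projectivization.mk k (comatrix (g : Mat k)) (comatrix_gl_ne_zero g))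

theorem embedGL_eq {g h : GL (Fin 3) k}
    (hgh : Matrix.ProjGenLinGroup.mk g = Matrix.ProjGenLinGroup.mk h) :
    embedGL g = embedGL h := by
  obtain ⟨u, hu⟩ := Matrix.ProjGenLinGroup.mk_eq_mk_iff.1 hgh
  have hm : (h : Mat k) = (u : k) • (g : Mat k) := by
    rw [← hu, Units.val_mul]
    change (g : Mat k) * Matrix.scalar (Fin 3) (u : k) = _
    rw [Matrix.scalar_apply, ← Matrix.smul_one_eq_diagonal, Matrix.mul_smul, mul_one]
  refine Prod.ext ?_ ?_
  · refine (Projectivization.mk_eq_mk_iff' k _ _ _ _).2 ⟨(u : k)⁻¹, ?_⟩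
    rw [hm, smul_smul, inv_mul_cancel₀ u.ne_zero, one_smul]
  · refine (Projectivization.mk_eq_mk_iff' k _ _ _ _).2 ⟨((u : k) ^ 2)⁻¹, ?_⟩
    rw [hm, comatrix_smul, smul_smul, inv_mul_cancel₀ (pow_ne_zero 2 u.ne_zero), one_smul]

/-- The immersion `PGL₃(k) → ℙ(M₃(k)) × ℙ(M₃(k))`, `[g] ↦ ([g], [Com g])`. -/
def embed (g : PGL(3, k)) : BiProj k :=
  Quotient.liftOn g embedGL fun _ _ h => embedGL_eq (Quotient.sound h)

variable (k) in
/-- The wonderful compactification of `PGL₃(k)`: the closure of the image of the immersion, with the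
induced Zariski topology. -/
abbrev Gbar : Type _ := {x : BiProj k // x ∈ closure (Set.range (embed (k := k)))}

/-- The class in `PGL₃(k)` of an invertible matrix, as a point of the compactification. -/
def pt (g : GL (Fin 3) k) : Gbar k :=
  ⟨embed (Matrix.ProjGenLinGroup.mk g), subset_closure ⟨_, rfl⟩⟩

end Compactification

/-! ### Regular functions -/

section Regular

variable {k : Type*} [Field k]

/-- The `k`-algebra `𝒪(V)` of regular functions on an open set `V`: functions which, near each point,
are quotients of two bihomogeneous polynomials of the same bidegree. -/
def regular (V : Opens (Gbar k)) : Subalgebra k (V → k) where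
  carrier := {f | ∀ x : V, ∃ (d : ℕ × ℕ) (A B : MvPolynomial BiIdx k) (W : Opens (Gbar k)),
    IsBihom A d ∧ IsBihom B d ∧ (x : Gbar k) ∈ W ∧
      ∀ y : V, (y : Gbar k) ∈ W →
        y.1.1.evalAt B ≠ 0 ∧ f y = y.1.1.evalAt A / y.1.1.evalAt B}
  mul_mem' := by
    intro f g hf hg x
    obtain ⟨d, A, B, W, hA, hB, hx, h⟩ := hf x
    obtain ⟨d', A', B', W', hA', hB', hx', h'⟩ := hg x
    refine ⟨d + d', A * A', B * B', W ⊓ W', hA.mul hA', hB.mul hB', ⟨hx, hx'⟩, fun y hy => ?_⟩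
    obtain ⟨h1, h2⟩ := h y hy.1
    obtain ⟨h1', h2'⟩ := h' y hy.2
    simp only [BiProj.evalAt, map_mul, Pi.mul_apply] at *
    refine ⟨mul_ne_zero h1 h1', ?_⟩
    rw [h2, h2', div_mul_div_comm]
  add_mem' := by
    intro f g hf hg x
    obtain ⟨d, A, B, W, hA, hB, hx, h⟩ := hf x
    obtain ⟨d', A', B', W', hA', hB', hx', h'⟩ := hg x
    refine ⟨d + d', A * B' + B * A', B * B', W ⊓ W', ?_, hB.mul hB', ⟨hx, hx'⟩, fun y hy => ?_⟩
    · exact (hA.mul hB').add (hB.mul hA')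
    obtain ⟨h1, h2⟩ := h y hy.1
    obtain ⟨h1', h2'⟩ := h' y hy.2
    simp only [BiProj.evalAt, map_mul, map_add, Pi.add_apply] at *
    refine ⟨mul_ne_zero h1 h1', ?_⟩
    rw [h2, h2', div_add_div _ _ h1 h1']
  algebraMap_mem' := by
    intro c x
    refine ⟨0, C c, 1, ⊤, isWeightedHomogeneous_C _ _, isWeightedHomogeneous_one _ _, trivial,
      fun y _ => ?_⟩
    simp [BiProj.evalAt]

/-- Restriction of regular functions. -/
def res {V W : Opens (Gbar k)} (h : W ≤ V) : regular V →ₐ[k] regular W where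
  toFun f := ⟨fun x => f.1 ⟨x.1, h x.2⟩, fun x => by
    obtain ⟨d, A, B, W', hA, hB, hx, h'⟩ := f.2 ⟨x.1, h x.2⟩
    exact ⟨d, A, B, W', hA, hB, hx, fun y hy => h' ⟨y.1, h y.2⟩ hy⟩⟩
  map_one' := rfl
  map_mul' _ _ := rfl
  map_zero' := rfl
  map_add' _ _ := rfl
  commutes' _ := rfl

/-- The quotient of two bihomogeneous polynomials of the same bidegree, as a regular function on an
open set where the denominator does not vanish. -/
def frac (V : Opens (Gbar k)) (d : ℕ × ℕ) (A B : MvPolynomial BiIdx k)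
    (hA : IsBihom A d) (hB : IsBihom B d) (h : ∀ y : V, y.1.1.evalAt B ≠ 0) : regular V :=
  ⟨fun y => y.1.1.evalAt A / y.1.1.evalAt B, fun _ =>
    ⟨d, A, B, ⊤, hA, hB, trivial, fun y _ => ⟨h y, rfl⟩⟩⟩

end Regular

/-! ### Differential operators -/

section DiffOp

variable {k : Type*} [Field k]

/-- `k`-linear endomorphisms of the sheaf `𝒪_U`. -/
@[ext]
structure SheafEnd (U : Opens (Gbar k)) where
  /-- the endomorphism of `𝒪(V)`, for each open `V ⊆ U` -/
  app : ∀ V : Opens (Gbar k), V ≤ U → (regular V →ₗ[k] regular V)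
  /-- compatibility with restriction -/
  naturality : ∀ (V W : Opens (Gbar k)) (hV : V ≤ U) (hWV : W ≤ V) (f : regular V),
    res hWV (app V hV f) = app W (hWV.trans hV) (res hWV f)

namespace SheafEnd

variable {U : Opens (Gbar k)}

/-- Restriction to a smaller open set. -/
def restrict {V : Opens (Gbar k)} (D : SheafEnd U) (h : V ≤ U) : SheafEnd V where
  app W hW := D.app W (hW.trans h)
  naturality W W' hW hW' f := D.naturality W W' (hW.trans h) hW' f

/-- Composition. -/
def comp (D E : SheafEnd U) : SheafEnd U where
  app V hV := D.app V hV ∘ₗ E.app V hV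
  naturality V W hV hW f := by
    simp only [LinearMap.comp_apply]
    rw [D.naturality V W hV hW, E.naturality V W hV hW]

/-- Multiplication by a regular function. -/
def mulBy (a : regular U) : SheafEnd U where
  app V hV := LinearMap.mulLeft k (res hV a)
  naturality V W hV hW f := by
    simp only [LinearMap.mulLeft_apply, map_mul]
    rfl

/-- The commutator `[D, a]` of an endomorphism with multiplication by a regular function `a`. -/
def commutator (D : SheafEnd U) (a : regular U) : SheafEnd U where
  app V hV := (D.comp (mulBy a)).app V hV - ((mulBy a).comp D).app V hV
  naturality V W hV hW f := by
    simp only [LinearMap.sub_apply, map_sub]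
    rw [(D.comp (mulBy a)).naturality V W hV hW, ((mulBy a).comp D).naturality V W hV hW]

/-- `D` is a differential operator of order at most `n` on `U`. -/
def IsDiffOp : ℕ → ∀ U : Opens (Gbar k), SheafEnd U → Prop
  | 0, U, D => ∃ a : regular U, D = mulBy a
  | n + 1, U, D => ∀ (V : Opens (Gbar k)) (hV : V ≤ U) (a : regular V),
      IsDiffOp n V ((D.restrict hV).commutator a)

/-- `D` is a `k`-linear derivation of the sheaf `𝒪_U`. -/
def IsDerivation (D : SheafEnd U) : Prop :=
  ∀ (V : Opens (Gbar k)) (hV : V ≤ U) (f g : regular V),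
    D.app V hV (f * g) = f * D.app V hV g + g * D.app V hV f

end SheafEnd

end DiffOp

/-! ### The big cell and its coordinates -/

section BigCell

variable (k : Type*) [Field k]

/-- The homogeneous coordinate `g i j`. -/
def gX (i j : Fin 3) : MvPolynomial BiIdx k := X (Sum.inl (i, j))

/-- The homogeneous coordinate `g' i j`. -/
def gX' (i j : Fin 3) : MvPolynomial BiIdx k := X (Sum.inr (i, j))

variable {k}

theorem isBihom_gX (i j : Fin 3) : IsBihom (gX k i j) (1, 0) := isWeightedHomogeneous_X _ _ _

theorem isBihom_gX' (i j : Fin 3) : IsBihom (gX' k i j) (0, 1) := isWeightedHomogeneous_X _ _ _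

theorem IsBihom.sub {A B : MvPolynomial BiIdx k} {d : ℕ × ℕ} (hA : IsBihom A d)
    (hB : IsBihom B d) : IsBihom (A - B) d :=
  (weightedHomogeneousSubmodule k _ d).sub_mem hA hB

theorem IsBihom.neg {A : MvPolynomial BiIdx k} {d : ℕ × ℕ} (hA : IsBihom A d) : IsBihom (-A) d :=
  (weightedHomogeneousSubmodule k _ d).neg_mem hA

theorem IsBihom.mul {A B : MvPolynomial BiIdx k} {d e : ℕ × ℕ} (hA : IsBihom A d)
    (hB : IsBihom B e) : IsBihom (A * B) (d + e) :=
  IsWeightedHomogeneous.mul hA hB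

theorem isOpen_ne_zero {F : MvPolynomial BiIdx k} {d : ℕ × ℕ} (hF : IsBihom F d) :
    IsOpen {x : Gbar k | x.1.evalAt F ≠ 0} :=
  (TopologicalSpace.isOpen_generateFrom_of_mem ⟨d, F, hF, rfl⟩ :
    IsOpen {x : BiProj k | x.evalAt F ≠ 0}).preimage continuous_subtype_val

variable (k) in
/-- The big cell `{g₃₃ ≠ 0, g'₁₁ ≠ 0}`. (Rows and columns `1, 2, 3` have the indices `0, 1, 2`.) -/
def bigCell : Opens (Gbar k) :=
  ⟨{x | x.1.evalAt (gX k 2 2) ≠ 0} ∩ {x | x.1.evalAt (gX' k 0 0) ≠ 0},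
    (isOpen_ne_zero (isBihom_gX 2 2)).inter (isOpen_ne_zero (isBihom_gX' 0 0))⟩

/-- Names of the eight coordinates on the big cell. -/
inductive Coord
  | α₁ | α₂ | U₁₂ | U₁₃ | U₂₃ | U₂₁ | U₃₁ | U₃₂

/-- The coordinates on the big cell. At the point
`u · ([diag(t₂t'₂, t₂, 1)], [diag(1, t'₂, t₂t'₂)]) · u'`, where `u` is upper and `u'` is lower
unitriangular, `α₁ = t'₂`, `α₂ = t₂`, and the `Uᵢⱼ` are the off-diagonal entries of `u` and `u'`.
In terms of the two matrices, up to scalars, `g = u diag(t₂t'₂, t₂, 1) u'` and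
`g' = Com(u) diag(1, t'₂, t₂t'₂) Com(u')`, this gives the formulas below. -/
def coord : Coord → regular (bigCell k)
  | .α₁ => frac (bigCell k) ((0, 1) + (0, 1))
      (gX' k 0 0 * gX' k 1 1 - gX' k 0 1 * gX' k 1 0) (gX' k 0 0 * gX' k 0 0)
      (((isBihom_gX' 0 0).mul (isBihom_gX' 1 1)).sub ((isBihom_gX' 0 1).mul (isBihom_gX' 1 0)))
      ((isBihom_gX' 0 0).mul (isBihom_gX' 0 0))
      (fun y => by
        have := y.2.2
        simp only [BiProj.evalAt, map_mul, Set.mem_ofPred_eq] at *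
        exact mul_ne_zero this this)
  | .α₂ => frac (bigCell k) ((1, 0) + (1, 0))
      (gX k 1 1 * gX k 2 2 - gX k 1 2 * gX k 2 1) (gX k 2 2 * gX k 2 2)
      (((isBihom_gX 1 1).mul (isBihom_gX 2 2)).sub ((isBihom_gX 1 2).mul (isBihom_gX 2 1)))
      ((isBihom_gX 2 2).mul (isBihom_gX 2 2))
      (fun y => by
        have := y.2.1
        simp only [BiProj.evalAt, map_mul, Set.mem_ofPred_eq] at *
        exact mul_ne_zero this this)
  | .U₁₂ => frac (bigCell k) (0, 1) (-gX' k 1 0) (gX' k 0 0) (isBihom_gX' 1 0).neg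
      (isBihom_gX' 0 0) (fun y => y.2.2)
  | .U₂₁ => frac (bigCell k) (0, 1) (-gX' k 0 1) (gX' k 0 0) (isBihom_gX' 0 1).neg
      (isBihom_gX' 0 0) (fun y => y.2.2)
  | .U₁₃ => frac (bigCell k) (1, 0) (gX k 0 2) (gX k 2 2) (isBihom_gX 0 2)
      (isBihom_gX 2 2) (fun y => y.2.1)
  | .U₂₃ => frac (bigCell k) (1, 0) (gX k 1 2) (gX k 2 2) (isBihom_gX 1 2)
      (isBihom_gX 2 2) (fun y => y.2.1)
  | .U₃₁ => frac (bigCell k) (1, 0) (gX k 2 0) (gX k 2 2) (isBihom_gX 2 0)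
      (isBihom_gX 2 2) (fun y => y.2.1)
  | .U₃₂ => frac (bigCell k) (1, 0) (gX k 2 1) (gX k 2 2) (isBihom_gX 2 1)
      (isBihom_gX 2 2) (fun y => y.2.1)

open Classical in
/-- `D` is the coordinate vector field `∂_c` on the big cell: the derivation of the structure sheaf
which takes the coordinate `c` to `1` and the seven others to `0`. -/
def IsPartial (c : Coord) (D : SheafEnd (bigCell k)) : Prop :=
  D.IsDerivation ∧
    ∀ e : Coord, D.app (bigCell k) le_rfl (coord e) = if e = c then 1 else 0

end BigCell

/-! ### Operators in matrix coordinates -/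

section Matrix

/-- The polynomial ring `k[g i j]` in the nine matrix entries. -/
abbrev MatPoly (k : Type*) [Field k] := MvPolynomial (Fin 3 × Fin 3) k

/-- The field `k(g i j)` of rational functions of the matrix entries. -/
abbrev RatFun (k : Type*) [Field k] := FractionRing (MatPoly k)

variable {k : Type*} [Field k]

/-- The algebra map `a ↦ a + ε δ(a)` to the dual numbers over `k(g i j)`. -/
def dualHom (δ : Derivation k (MatPoly k) (MatPoly k)) :
    MatPoly k →+* TrivSqZeroExt (RatFun k) (RatFun k) where
  toFun a := TrivSqZeroExt.inl (algebraMap _ _ a) + TrivSqZeroExt.inr (algebraMap _ _ (δ a))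
  map_one' := by ext <;> simp
  map_zero' := by ext <;> simp
  map_add' a b := by ext <;> simp [Algebra.smul_def, add_mul]
  map_mul' a b := by
    ext
    · simp
    · simp
      rw [Algebra.smul_def, Algebra.smul_def]
      ring

theorem dualHom_isUnit (δ : Derivation k (MatPoly k) (MatPoly k))
    (y : nonZeroDivisors (MatPoly k)) : IsUnit (dualHom δ y) := by
  rw [TrivSqZeroExt.isUnit_iff_isUnit_fst]
  have : (dualHom δ y).fst = algebraMap (MatPoly k) (RatFun k) y := by simp [dualHom]
  rw [this]
  exact IsLocalization.map_units _ y

/-- `dualHom δ` extended to rational functions. -/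
def dualLift (δ : Derivation k (MatPoly k) (MatPoly k)) :
    RatFun k →+* TrivSqZeroExt (RatFun k) (RatFun k) :=
  IsLocalization.lift (M := nonZeroDivisors (MatPoly k)) (dualHom_isUnit δ)

theorem dualLift_algebraMap (δ : Derivation k (MatPoly k) (MatPoly k)) (a : MatPoly k) :
    dualLift δ (algebraMap _ _ a) =
      TrivSqZeroExt.inl (algebraMap _ _ a) + TrivSqZeroExt.inr (algebraMap _ _ (δ a)) :=
  IsLocalization.lift_eq _ _

theorem dualLift_fst (δ : Derivation k (MatPoly k) (MatPoly k)) (r : RatFun k) :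
    (dualLift δ r).fst = r := by
  have : ((TrivSqZeroExt.fstHom (RatFun k) (RatFun k) (RatFun k)).toRingHom.comp (dualLift δ))
      = RingHom.id _ := by
    apply IsLocalization.ringHom_ext (nonZeroDivisors (MatPoly k))
    ext a <;> simp [dualLift_algebraMap]
  exact RingHom.congr_fun this r

/-- The unique extension of a derivation of `k[g i j]` to `k(g i j)`. -/
def extendDer (δ : Derivation k (MatPoly k) (MatPoly k)) :
    Derivation k (RatFun k) (RatFun k) :=
  Derivation.mk'
    { toFun := fun r => (dualLift δ r).snd
      map_add' := fun a b => by simp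
      map_smul' := fun c a => by
        have h : dualLift δ (algebraMap k (RatFun k) c) =
            TrivSqZeroExt.inl (algebraMap k (RatFun k) c) := by
          rw [IsScalarTower.algebraMap_apply k (MatPoly k) (RatFun k), dualLift_algebraMap]
          simp
        rw [Algebra.smul_def, map_mul, h]
        simp [Algebra.smul_def] }
    (fun a b => by
      simp [dualLift_fst, mul_comm])

theorem extendDer_algebraMap (δ : Derivation k (MatPoly k) (MatPoly k)) (a : MatPoly k) :
    extendDer δ (algebraMap _ _ a) = algebraMap _ _ (δ a) := by
  simp [extendDer, dualLift_algebraMap]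
  rw [Algebra.smul_def, mul_one]

theorem ratFun_derivation_ext {D E : Derivation k (RatFun k) (RatFun k)}
    (h : ∀ p, D (algebraMap (MatPoly k) _ (X p)) = E (algebraMap (MatPoly k) _ (X p))) :
    D = E := by
  have h1 : D.compAlgebraMap (MatPoly k) = E.compAlgebraMap (MatPoly k) :=
    MvPolynomial.derivation_ext h
  have h2 : ∀ a : MatPoly k, D (algebraMap _ _ a) = E (algebraMap _ _ a) :=
    fun a => Derivation.congr_fun h1 a
  ext r
  obtain ⟨a, b, hb, rfl⟩ := IsFractionRing.div_surjective (A := MatPoly k) r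
  rw [Derivation.leibniz_div, Derivation.leibniz_div, h2, h2]

/-- The partial derivative `∂/∂g i j` on `k(g i j)`. -/
def pd (i j : Fin 3) : Module.End k (RatFun k) := (extendDer (pderiv (i, j))).toLinearMap

/-- The minor `Δ i j` of the generic matrix `(g i j)`: remove row `i` and column `j`. -/
def minor (i j : Fin 3) : RatFun k :=
  algebraMap (MatPoly k) (RatFun k)
    ((Matrix.mvPolynomialX (Fin 3) (Fin 3) k).submatrix i.succAbove j.succAbove).det

variable (k) in
/-- The operator `∂_{g₁₁} (Δ₂₂ ∂_{g₁₁} + Δ₁₁ ∂_{g₂₂} + Δ₂₁ ∂_{g₁₂} + Δ₁₂ ∂_{g₂₁})`.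
(Rows and columns `1, 2, 3` have the indices `0, 1, 2`.) -/
def matrixOperator : Module.End k (RatFun k) :=
  pd 0 0 * (LinearMap.mulLeft k (minor 1 1) * pd 0 0 + LinearMap.mulLeft k (minor 0 0) * pd 1 1 +
    LinearMap.mulLeft k (minor 1 0) * pd 0 1 + LinearMap.mulLeft k (minor 0 1) * pd 1 0)

/-- The rational function `r` of the matrix entries represents the regular function `f` on `V`, that
is, `r(g) = f([g])` for the invertible matrices `g` with class in `V`. -/
def Represents {V : Opens (Gbar k)} (r : RatFun k) (f : regular V) : Prop :=
  ∃ P Q : MatPoly k, Q ≠ 0 ∧ r = algebraMap _ _ P / algebraMap _ _ Q ∧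
    ∀ (g : GL (Fin 3) k) (hg : pt g ∈ V),
      f.1 ⟨pt g, hg⟩ * eval (fun p => (g : Mat k) p.1 p.2) Q = eval (fun p => (g : Mat k) p.1 p.2) P

/-- The endomorphism `D` of the structure sheaf of the compactification is given, in matrix
coordinates, by the operator `T` on rational functions. -/
def GivenBy (D : SheafEnd (⊤ : Opens (Gbar k))) (T : Module.End k (RatFun k)) : Prop :=
  ∀ (V : Opens (Gbar k)) (f : regular V) (r : RatFun k),
    Represents r f → Represents (T r) (D.app V le_top f)

end Matrix

/-! ### The action of the enveloping algebra -/

section Action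

variable (k : Type*) [Field k]

/-- The Lie algebra `𝔤 = 𝔰𝔩₃`. -/
abbrev Lie3 := LieAlgebra.SpecialLinear.sl (Fin 3) k

variable {k}

attribute [local instance 100] LieRing.ofAssociativeRing

/-- The derivation of `k(g i j)` with `g ↦ -X g + g Y`: the infinitesimal action of
`(X, Y) ∈ 𝔤 × 𝔤` attached to `((h, h') · f)(g) = f(h⁻¹ g h')`. -/
def vectorField (Z : Lie3 k × Lie3 k) : Derivation k (RatFun k) (RatFun k) :=
  extendDer (mkDerivation k fun p =>
    -(∑ l, C (Z.1.1 p.1 l) * X (l, p.2)) + ∑ l, X (p.1, l) * C (Z.2.1 l p.2))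

theorem vectorField_X (Z : Lie3 k × Lie3 k) (i j : Fin 3) :
    vectorField Z (algebraMap (MatPoly k) _ (X (i, j))) = algebraMap (MatPoly k) _
      (-(∑ l, C (Z.1.1 i l) * X (l, j)) + ∑ l, X (i, l) * C (Z.2.1 l j)) := by
  rw [vectorField, extendDer_algebraMap, mkDerivation_X]

theorem vectorField_C (Z : Lie3 k × Lie3 k) (c : k) :
    vectorField Z (algebraMap (MatPoly k) _ (C c)) = 0 := by
  rw [vectorField, extendDer_algebraMap, derivation_C, map_zero]

variable (k) in
/-- The action of `𝔤 × 𝔤` on rational functions of the matrix entries. -/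
def lieAction : (Lie3 k × Lie3 k) →ₗ⁅k⁆ Module.End k (RatFun k) where
  toFun Z := (vectorField Z).toLinearMap
  map_add' Z W := by
    rw [← Derivation.coe_add_linearMap]
    congr 1
    refine ratFun_derivation_ext fun p => ?_
    obtain ⟨i, j⟩ := p
    rw [Derivation.add_apply, vectorField_X, vectorField_X, vectorField_X, ← map_add]
    congr 1
    simp [Fin.sum_univ_three]
    ring
  map_smul' c Z := by
    rw [RingHom.id_apply, ← Derivation.coe_smul_linearMap]
    congr 1
    refine ratFun_derivation_ext fun p => ?_
    obtain ⟨i, j⟩ := p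
    rw [Derivation.smul_apply, vectorField_X, vectorField_X, Algebra.smul_def,
      IsScalarTower.algebraMap_apply k (MatPoly k) (RatFun k), ← map_mul]
    congr 1
    simp [Fin.sum_univ_three, MvPolynomial.algebraMap_eq]
    ring
  map_lie' := by
    intro Z W
    have : vectorField ⁅Z, W⁆ = ⁅vectorField Z, vectorField W⁆ := by
      refine ratFun_derivation_ext fun p => ?_
      obtain ⟨i, j⟩ := p
      rw [Derivation.commutator_apply, vectorField_X, vectorField_X, vectorField_X]
      simp only [Fin.sum_univ_three, map_add, map_neg, map_mul, Derivation.leibniz, vectorField_X,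
        vectorField_C, LieAlgebra.Prod.bracket_apply, LieAlgebra.SpecialLinear.sl_bracket,
        Matrix.sub_apply, Matrix.mul_apply, map_sub, smul_eq_mul]
      ring
    change (vectorField ⁅Z, W⁆).toLinearMap = _
    rw [this]
    rfl

variable (k) in
/-- The action of the enveloping algebra `U(𝔤 × 𝔤)` on rational functions of the matrix entries. -/
def envelopingAction :
    UniversalEnvelopingAlgebra k (Lie3 k × Lie3 k) →ₐ[k] Module.End k (RatFun k) :=
  UniversalEnvelopingAlgebra.lift k (lieAction k)

end Action

end WonderfulPGL3

end

open WonderfulPGL3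

/-! Because PGL₃ is dense in the compactification, a regular function on a nonempty open set amounts
to one rational function of the entries of g lying in the local ring of each point of that set,
where g' is read as c = Com g. An operator on k(g_ij) preserving all these local rings is thus an
endomorphism of the structure sheaf (`SheafEnd.ofOperator`), and every claim becomes a computation
with rational functions.

Write D₀ = ∂ ∘ E with ∂ = ∂/∂g₁₁ and E = `minorField`. The field E is g₃₃ times the Euler field that
scales the Schur complement of g₃₃. On the big cell, lifted so as to kill g₃₃, the coordinate fields
are ∂_{α₁} = (c₁₁/g₃₃)∂ and ∂_{α₂} = (g₃₃/c₁₁)E. As ∂ kills g₃₃/c₁₁, their composite is ∂ ∘ E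
(`matrixOperator_eq_comp`).

The factors ∂ and E have degrees -1 and +1 in g, so neither acts on functions of [g] alone, but the
composite does. It preserves a local ring once its symbol and its values are regular on generators
(`GeneratesLocalRing.comp_mem`). The generators are the ratios g_i/g_p and c_i/c_q. Regularity means
rewriting numerators in the bidegree of their denominators, which works because c is quadratic in g
and det·g is quadratic in c (`detR_mul_gR`), and because E(c_i/c_q) carries a factor det
(`minorField_cR`).

Derivations on the big cell are determined by the coordinates, since these generate its local rings
(`generatesLocalRing_coordR`). The extension is unique because the big cell is dense. The values of
D₀ on 1, α₁, α₂, α₁α₂ exclude order ≤ 1. Finally, 𝔰𝔩₃ × 𝔰𝔩₃ kills det, so its enveloping algebra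
preserves the functions vanishing on det = 0. Now α₁α₂ = det/(g₃₃c₁₁) is such a function, whereas
D₀(α₁α₂) = 1 is not. -/

noncomputable section

namespace WonderfulPGL3

/-! ### Bihomogeneous polynomials and irreducibility of the compactification -/

section Irreducible

variable {k : Type*} [Field k]

/-- Each monomial of F has d.1 factors from the first block of variables and d.2 from the second. -/
theorem IsBihom.aeval_smul {R : Type*} [CommRing R] [Algebra k R] {F : MvPolynomial BiIdx k}
    {d : ℕ × ℕ} (hF : IsBihom F d) (s t : R) (u v : Fin 3 × Fin 3 → R) :
    aeval (Sum.elim (fun p => s * u p) (fun p => t * v p)) F =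
      s ^ d.1 * t ^ d.2 * aeval (Sum.elim u v) F := by
  rw [aeval_def, aeval_def, eval₂_eq', eval₂_eq', Finset.mul_sum]
  refine Finset.sum_congr rfl fun m hm => ?_
  have hw := hF (mem_support_iff.1 hm)
  rw [Finsupp.weight_apply, Finsupp.sum_fintype _ _ (by simp), Fintype.sum_sum_type] at hw
  have h1 : ∑ p, m (Sum.inl p) = d.1 := by
    rw [← hw]; simp [Prod.fst_sum]
  have h2 : ∑ p, m (Sum.inr p) = d.2 := by
    rw [← hw]; simp [Prod.snd_sum]
  simp only [Fintype.prod_sum_type, Sum.elim_inl, Sum.elim_inr, mul_pow, Finset.prod_mul_distrib,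
    Finset.prod_pow_eq_pow_sum, h1, h2]
  ring

variable (k) in
/-- The generic matrix. -/
abbrev genMat : Matrix (Fin 3) (Fin 3) (MatPoly k) := Matrix.mvPolynomialX (Fin 3) (Fin 3) k

variable (k) in
/-- The substitution `g' ↦ Com g`. -/
def toMat : MvPolynomial BiIdx k →ₐ[k] MatPoly k :=
  aeval (Sum.elim X (fun p => (genMat k).adjugate p.2 p.1))

variable (k) in
/-- The substitution `g' ↦ Com g`, with values in rational functions. -/
def toRat : MvPolynomial BiIdx k →ₐ[k] RatFun k :=
  (IsScalarTower.toAlgHom k (MatPoly k) (RatFun k)).comp (toMat k)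

theorem toRat_apply (F : MvPolynomial BiIdx k) :
    toRat k F = algebraMap (MatPoly k) (RatFun k) (toMat k F) := rfl

/-- Evaluation of a polynomial in the matrix entries at a matrix. -/
abbrev evalMat (g : Mat k) : MatPoly k →+* k := eval fun p => g p.1 p.2

theorem map_evalMat_genMat (g : Mat k) : (evalMat g).mapMatrix (genMat k) = g := by
  ext i j
  simp [Matrix.mvPolynomialX]

theorem evalMat_toMat (g : Mat k) (F : MvPolynomial BiIdx k) :
    evalMat g (toMat k F) =
      aeval (Sum.elim (fun p => g p.1 p.2) (fun p => comatrix g p.1 p.2)) F := by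
  have : ((aeval fun p : Fin 3 × Fin 3 => g p.1 p.2 : MatPoly k →ₐ[k] k).comp (toMat k)) =
      aeval (Sum.elim (fun p => g p.1 p.2) (fun p => comatrix g p.1 p.2)) := by
    ext i
    rcases i with p | p
    · simp [toMat]
    · simp only [toMat, AlgHom.comp_apply, aeval_X, Sum.elim_inr, comatrix,
        Matrix.transpose_apply]
      have h := (evalMat g).map_adjugate (genMat k)
      rw [map_evalMat_genMat] at h
      rw [← h]
      rfl
  exact DFunLike.congr_fun this F

theorem evalMat_det (g : Mat k) : evalMat g (genMat k).det = g.det := by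
  rw [RingHom.map_det, map_evalMat_genMat]

/-- The chosen representatives of [g] and [Com g] differ from g and Com g by scalars independent of
F, so these cancel in a quotient of two forms of one bidegree. -/
theorem evalAt_pt (g : GL (Fin 3) k) : ∃ s t : k, s ≠ 0 ∧ t ≠ 0 ∧
    ∀ (d : ℕ × ℕ) (F : MvPolynomial BiIdx k), IsBihom F d →
      (pt g).1.evalAt F = s ^ d.1 * t ^ d.2 * evalMat (g : Mat k) (toMat k F) := by
  obtain ⟨s, hs⟩ := Projectivization.exists_smul_eq_mk_rep k (g : Mat k) (gl_ne_zero g)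
  obtain ⟨t, ht⟩ := Projectivization.exists_smul_eq_mk_rep k (comatrix (g : Mat k))
    (comatrix_gl_ne_zero g)
  refine ⟨s, t, s.ne_zero, t.ne_zero, fun d F hF => ?_⟩
  rw [evalMat_toMat, ← hF.aeval_smul]
  have h1 : (pt g).1.1.rep = s • (g : Mat k) := hs.symm
  have h2 : (pt g).1.2.rep = t • comatrix (g : Mat k) := ht.symm
  rw [BiProj.evalAt, h1, h2]
  rfl

theorem isTopologicalBasis_biProj : IsTopologicalBasis
    {U : Set (BiProj k) | ∃ (d : ℕ × ℕ) (F : MvPolynomial BiIdx k),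
      IsBihom F d ∧ U = {x | x.evalAt F ≠ 0}} := by
  have h := isTopologicalBasis_of_subbasis_of_inter (α := BiProj k) rfl
    (r := {U : Set (BiProj k) | ∃ (d : ℕ × ℕ) (F : MvPolynomial BiIdx k),
      IsBihom F d ∧ U = {x | x.evalAt F ≠ 0}}) (by
    rintro _ ⟨d, F, hF, rfl⟩ _ ⟨e, G, hG, rfl⟩
    refine ⟨d + e, F * G, hF.mul hG, ?_⟩
    ext x
    simp [BiProj.evalAt])
  rwa [Set.insert_eq_of_mem] at h
  refine ⟨0, 1, isWeightedHomogeneous_one _ _, ?_⟩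
  ext x
  simp [BiProj.evalAt]

theorem exists_bihom_of_mem {V : Opens (Gbar k)} {x : Gbar k} (hx : x ∈ V) :
    ∃ (d : ℕ × ℕ) (F : MvPolynomial BiIdx k), IsBihom F d ∧ x.1.evalAt F ≠ 0 ∧
      ∀ y : Gbar k, y.1.evalAt F ≠ 0 → y ∈ V := by
  obtain ⟨V', hV', h⟩ := isOpen_induced_iff.1 V.2
  have hx' : x.1 ∈ V' := by
    change x ∈ V.carrier at hx
    rwa [← h] at hx
  obtain ⟨_, ⟨d, F, hF, rfl⟩, hxF, hsub⟩ :=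
    isTopologicalBasis_biProj.exists_subset_of_mem_open hx' hV'
  refine ⟨d, F, hF, hxF, fun y hy => ?_⟩
  change y ∈ V.carrier
  rw [← h]
  exact hsub hy

/-- The nonvanishing locus of F is open and misses the image of PGL₃, hence misses the closure. -/
theorem evalAt_eq_zero {F : MvPolynomial BiIdx k} {d : ℕ × ℕ} (hF : IsBihom F d)
    (h : toMat k F = 0) (x : Gbar k) : x.1.evalAt F = 0 := by
  by_contra hx
  have ho : IsOpen {x : BiProj k | x.evalAt F ≠ 0} :=
    TopologicalSpace.isOpen_generateFrom_of_mem ⟨d, F, hF, rfl⟩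
  obtain ⟨_, hy, g, rfl⟩ := mem_closure_iff.1 x.2 _ ho hx
  obtain ⟨g, rfl⟩ := Matrix.ProjGenLinGroup.mk_surjective g
  obtain ⟨s, t, -, -, hst⟩ := evalAt_pt g
  have := hst d F hF
  rw [h, map_zero, mul_zero] at this
  exact hy this

theorem evalAt_mul (x : BiProj k) (F G : MvPolynomial BiIdx k) :
    x.evalAt (F * G) = x.evalAt F * x.evalAt G := map_mul _ _ _

theorem evalAt_add (x : BiProj k) (F G : MvPolynomial BiIdx k) :
    x.evalAt (F + G) = x.evalAt F + x.evalAt G := map_add _ _ _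

theorem evalAt_sub (x : BiProj k) (F G : MvPolynomial BiIdx k) :
    x.evalAt (F - G) = x.evalAt F - x.evalAt G := map_sub _ _ _

/-- Irreducibility in usable form: a nonempty open set contains all classes of invertible matrices
off some hypersurface, and finitely many such hypersurfaces are handled by multiplying their
equations. -/
theorem exists_dense {V : Opens (Gbar k)} {x : Gbar k} (hx : x ∈ V) :
    ∃ h : MatPoly k, h ≠ 0 ∧ ∀ g : GL (Fin 3) k, evalMat (g : Mat k) h ≠ 0 → pt g ∈ V := by
  obtain ⟨d, F, hF, hxF, hsub⟩ := exists_bihom_of_mem hx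
  refine ⟨toMat k F, fun h0 => hxF (evalAt_eq_zero hF h0 x), fun g hg => hsub _ ?_⟩
  obtain ⟨s, t, hs, ht, hst⟩ := evalAt_pt g
  rw [hst d F hF]
  exact mul_ne_zero (mul_ne_zero (pow_ne_zero _ hs) (pow_ne_zero _ ht)) hg

theorem det_genMat_ne_zero : (genMat k).det ≠ 0 := Matrix.det_mvPolynomialX_ne_zero _ _

/-- The product P·h·det vanishes at every matrix, so it is the zero polynomial over an infinite
field, and the polynomial ring is a domain. -/
theorem matPoly_eq_zero [Infinite k] {h P : MatPoly k} (hh : h ≠ 0)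
    (hP : ∀ g : GL (Fin 3) k, evalMat (g : Mat k) h ≠ 0 → evalMat (g : Mat k) P = 0) : P = 0 := by
  have : P * h * (genMat k).det = 0 := by
    refine MvPolynomial.funext fun v => ?_
    rw [map_mul, map_mul, map_zero]
    by_contra hne
    have h1 := right_ne_zero_of_mul hne
    have h2 := right_ne_zero_of_mul (left_ne_zero_of_mul hne)
    have h3 := left_ne_zero_of_mul (left_ne_zero_of_mul hne)
    have hv : v = fun p : Fin 3 × Fin 3 => (Matrix.of fun i j => v (i, j)) p.1 p.2 := rfl
    rw [hv] at h1 h2 h3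
    rw [evalMat_det] at h1
    exact h3 (hP (Matrix.GeneralLinearGroup.mkOfDetNeZero _ h1) h2)
  rcases mul_eq_zero.1 this with h1 | h1
  · exact (mul_eq_zero.1 h1).resolve_right hh
  · exact absurd h1 det_genMat_ne_zero

theorem exists_pt_mem [Infinite k] {V : Opens (Gbar k)} {x : Gbar k} (hx : x ∈ V)
    {P : MatPoly k} (hP : P ≠ 0) : ∃ g : GL (Fin 3) k, pt g ∈ V ∧ evalMat (g : Mat k) P ≠ 0 := by
  obtain ⟨h, hh, hV⟩ := exists_dense hx
  by_contra! hcon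
  exact hP (matPoly_eq_zero hh fun g hg => hcon g (hV g hg))

end Irreducible

/-! ### Germs of regular functions as rational functions of the matrix entries -/

section Germ

variable {k : Type*} [Field k]

/-- The rational function `r` is regular at `x`, with value `v`. -/
def IsGerm (x : Gbar k) (r : RatFun k) (v : k) : Prop :=
  ∃ (d : ℕ × ℕ) (A B : MvPolynomial BiIdx k), IsBihom A d ∧ IsBihom B d ∧ x.1.evalAt B ≠ 0 ∧
    r = toRat k A / toRat k B ∧ v = x.1.evalAt A / x.1.evalAt B

theorem algebraMap_ne_zero {P : MatPoly k} (h : P ≠ 0) :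
    algebraMap (MatPoly k) (RatFun k) P ≠ 0 := by
  rwa [Ne, FaithfulSMul.algebraMap_eq_zero_iff]

theorem toMat_ne_zero {x : Gbar k} {F : MvPolynomial BiIdx k} {d : ℕ × ℕ} (hF : IsBihom F d)
    (h : x.1.evalAt F ≠ 0) : toMat k F ≠ 0 := fun h0 => h (evalAt_eq_zero hF h0 x)

theorem toRat_ne_zero {x : Gbar k} {F : MvPolynomial BiIdx k} {d : ℕ × ℕ} (hF : IsBihom F d)
    (h : x.1.evalAt F ≠ 0) : toRat k F ≠ 0 := algebraMap_ne_zero (toMat_ne_zero hF h)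

theorem toRat_eq_zero {F : MvPolynomial BiIdx k} : toRat k F = 0 ↔ toMat k F = 0 := by
  rw [toRat_apply, FaithfulSMul.algebraMap_eq_zero_iff]

/-- Cross-multiplication gives a bihomogeneous polynomial that becomes zero under g' = Com g, hence
vanishes at boundary points too. This makes the value of a rational function at a boundary point
well defined. -/
theorem evalAt_div_eq {x : Gbar k} {A B A' B' : MvPolynomial BiIdx k} {d d' : ℕ × ℕ}
    (hA : IsBihom A d) (hB : IsBihom B d) (hA' : IsBihom A' d') (hB' : IsBihom B' d')
    (hx : x.1.evalAt B ≠ 0) (hx' : x.1.evalAt B' ≠ 0)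
    (h : toRat k A / toRat k B = toRat k A' / toRat k B') :
    x.1.evalAt A / x.1.evalAt B = x.1.evalAt A' / x.1.evalAt B' := by
  rw [div_eq_div_iff (toRat_ne_zero hB hx) (toRat_ne_zero hB' hx'), ← map_mul, ← map_mul,
    ← sub_eq_zero, ← map_sub, toRat_eq_zero] at h
  have hb : IsBihom (A * B' - A' * B) (d + d') := by
    refine (hA.mul hB').sub ?_
    rw [add_comm]
    exact hA'.mul hB
  have := evalAt_eq_zero hb h x
  rw [evalAt_sub, evalAt_mul, evalAt_mul, sub_eq_zero] at this
  rw [div_eq_div_iff hx hx', this]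

namespace IsGerm

variable {x : Gbar k} {r s : RatFun k} {v w : k}

theorem unique (h : IsGerm x r v) (h' : IsGerm x r w) : v = w := by
  obtain ⟨d, A, B, hA, hB, hx, rfl, rfl⟩ := h
  obtain ⟨d', A', B', hA', hB', hx', h, rfl⟩ := h'
  exact evalAt_div_eq hA hB hA' hB' hx hx' h

theorem add (h : IsGerm x r v) (h' : IsGerm x s w) : IsGerm x (r + s) (v + w) := by
  obtain ⟨d, A, B, hA, hB, hx, rfl, rfl⟩ := h
  obtain ⟨d', A', B', hA', hB', hx', rfl, rfl⟩ := h'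
  refine ⟨d + d', A * B' + B * A', B * B', (hA.mul hB').add (hB.mul hA'), hB.mul hB', ?_, ?_, ?_⟩
  · rw [evalAt_mul]
    exact mul_ne_zero hx hx'
  · rw [map_add, map_mul, map_mul, map_mul,
      div_add_div _ _ (toRat_ne_zero hB hx) (toRat_ne_zero hB' hx')]
  · rw [evalAt_add, evalAt_mul, evalAt_mul, evalAt_mul, div_add_div _ _ hx hx']

theorem mul (h : IsGerm x r v) (h' : IsGerm x s w) : IsGerm x (r * s) (v * w) := by
  obtain ⟨d, A, B, hA, hB, hx, rfl, rfl⟩ := h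
  obtain ⟨d', A', B', hA', hB', hx', rfl, rfl⟩ := h'
  refine ⟨d + d', A * A', B * B', hA.mul hA', hB.mul hB', ?_, ?_, ?_⟩
  · rw [evalAt_mul]
    exact mul_ne_zero hx hx'
  · rw [map_mul, map_mul, div_mul_div_comm]
  · rw [evalAt_mul, evalAt_mul, div_mul_div_comm]

variable (x) in
theorem const (c : k) : IsGerm x (algebraMap k (RatFun k) c) c := by
  refine ⟨0, C c, 1, isWeightedHomogeneous_C _ _, isWeightedHomogeneous_one _ _, ?_, ?_, ?_⟩
  · simp [BiProj.evalAt]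
  · have : (C c : MvPolynomial BiIdx k) = algebraMap k _ c := rfl
    rw [this, AlgHom.commutes, map_one, div_one]
  · simp [BiProj.evalAt]

theorem smul (c : k) (h : IsGerm x r v) : IsGerm x (c • r) (c * v) := by
  rw [Algebra.smul_def]
  exact (const x c).mul h

end IsGerm

/-- The local ring of the compactification at `x`, inside the field of rational functions. -/
def localRing (x : Gbar k) : Subalgebra k (RatFun k) where
  carrier := {r | ∃ v, IsGerm x r v}
  mul_mem' := by
    rintro _ _ ⟨v, hv⟩ ⟨w, hw⟩
    exact ⟨_, hv.mul hw⟩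
  add_mem' := by
    rintro _ _ ⟨v, hv⟩ ⟨w, hw⟩
    exact ⟨_, hv.add hw⟩
  algebraMap_mem' c := ⟨c, IsGerm.const x c⟩

theorem mem_localRing {x : Gbar k} {r : RatFun k} : r ∈ localRing x ↔ ∃ v, IsGerm x r v := Iff.rfl

open Classical in
/-- The value of `r` at `x`, if `r` is regular there. -/
def germValue (x : Gbar k) (r : RatFun k) : k := if h : ∃ v, IsGerm x r v then h.choose else 0

theorem isGerm_germValue {x : Gbar k} {r : RatFun k} (h : r ∈ localRing x) :
    IsGerm x r (germValue x r) := by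
  rw [germValue, dif_pos (mem_localRing.1 h)]
  exact Exists.choose_spec h

/-- The regular function `f` on `V` is given by the rational function `r`. -/
def IsGermOn {V : Opens (Gbar k)} (f : regular V) (r : RatFun k) : Prop :=
  ∀ x : V, IsGerm x.1 r (f.1 x)

theorem mem_regular_of_isGerm {V : Opens (Gbar k)} {φ : V → k} {r : RatFun k}
    (h : ∀ x : V, IsGerm x.1 r (φ x)) : φ ∈ regular V := by
  intro x
  obtain ⟨d, A, B, hA, hB, hx, rfl, -⟩ := h x
  exact ⟨d, A, B, ⟨_, isOpen_ne_zero hB⟩, hA, hB, hx, fun y hy =>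
    ⟨hy, (h y).unique ⟨d, A, B, hA, hB, hy, rfl, rfl⟩⟩⟩

theorem IsGerm.evalMat_eq {g : GL (Fin 3) k} {r : RatFun k} {v : k} (h : IsGerm (pt g) r v)
    {P Q : MatPoly k} (hQ : Q ≠ 0)
    (hr : r = algebraMap _ (RatFun k) P / algebraMap _ (RatFun k) Q) :
    v * evalMat (g : Mat k) Q = evalMat (g : Mat k) P := by
  obtain ⟨d, A, B, hA, hB, hx, rfl, rfl⟩ := h
  rw [div_eq_div_iff (toRat_ne_zero hB hx) (algebraMap_ne_zero hQ), toRat_apply, toRat_apply,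
    ← map_mul, ← map_mul] at hr
  have h := congrArg (evalMat (g : Mat k)) (FaithfulSMul.algebraMap_injective _ _ hr)
  rw [map_mul, map_mul] at h
  obtain ⟨s, t, hs, ht, hst⟩ := evalAt_pt g
  rw [hst d B hB] at hx
  rw [hst d A hA, hst d B hB, mul_div_mul_left _ _ (left_ne_zero_of_mul hx), div_mul_eq_mul_div,
    div_eq_iff (right_ne_zero_of_mul hx), h]

namespace IsGermOn

variable {V : Opens (Gbar k)} {f g : regular V} {r s : RatFun k}

theorem add (h : IsGermOn f r) (h' : IsGermOn g s) : IsGermOn (f + g) (r + s) :=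
  fun x => (h x).add (h' x)

theorem mul (h : IsGermOn f r) (h' : IsGermOn g s) : IsGermOn (f * g) (r * s) :=
  fun x => (h x).mul (h' x)

theorem smul (c : k) (h : IsGermOn f r) : IsGermOn (c • f) (c • r) := fun x => (h x).smul c

variable (V) in
theorem one : IsGermOn (1 : regular V) 1 := fun x => by
  have := IsGerm.const x.1 1
  rwa [map_one] at this

theorem neg (h : IsGermOn f r) : IsGermOn (-f) (-r) := by
  have := h.smul (-1)
  rwa [neg_one_smul, neg_one_smul] at this

theorem sub (h : IsGermOn f r) (h' : IsGermOn g s) : IsGermOn (f - g) (r - s) := by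
  rw [sub_eq_add_neg, sub_eq_add_neg]
  exact h.add h'.neg

theorem res {W : Opens (Gbar k)} (hW : W ≤ V) (h : IsGermOn f r) : IsGermOn (res hW f) r :=
  fun x => h ⟨x.1, hW x.2⟩

theorem mem_localRing (h : IsGermOn f r) {x : Gbar k} (hx : x ∈ V) : r ∈ localRing x :=
  ⟨_, h ⟨x, hx⟩⟩

theorem eq (h : IsGermOn f r) (h' : IsGermOn g r) : f = g := by
  apply Subtype.ext
  funext x
  exact (h x).unique (h' x)

theorem represents (h : IsGermOn f r) : Represents r f := by
  obtain ⟨P, Q, hQ, rfl⟩ := IsFractionRing.div_surjective (A := MatPoly k) r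
  exact ⟨P, Q, nonZeroDivisors.ne_zero hQ, rfl, fun g hg =>
    (h ⟨pt g, hg⟩).evalMat_eq (nonZeroDivisors.ne_zero hQ) rfl⟩

end IsGermOn

variable [Infinite k]

theorem Represents.eq {V : Opens (Gbar k)} {f : regular V} {r s : RatFun k} {x : Gbar k}
    (hx : x ∈ V) (h : Represents r f) (h' : Represents s f) : r = s := by
  obtain ⟨P, Q, hQ, rfl, hP⟩ := h
  obtain ⟨P', Q', hQ', rfl, hP'⟩ := h'
  rw [div_eq_div_iff (algebraMap_ne_zero hQ) (algebraMap_ne_zero hQ'), ← map_mul, ← map_mul]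
  congr 1
  rw [← sub_eq_zero]
  obtain ⟨h, hh, hV⟩ := exists_dense hx
  refine matPoly_eq_zero hh fun g hg => ?_
  have h1 := hP g (hV g hg)
  have h2 := hP' g (hV g hg)
  rw [map_sub, map_mul, map_mul, ← h1, ← h2]
  ring

theorem IsGermOn.unique {V : Opens (Gbar k)} {f : regular V} {r s : RatFun k} {x : Gbar k}
    (hx : x ∈ V) (h : IsGermOn f r) (h' : IsGermOn f s) : r = s :=
  Represents.eq hx h.represents h'.represents

/-- Fractions chosen near two points take the same values at the invertible matrices in their common
domain, and these suffice to identify them as rational functions. -/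
theorem exists_isGermOn {V : Opens (Gbar k)} (f : regular V) : ∃ r, IsGermOn f r := by
  rcases isEmpty_or_nonempty V with hV | ⟨⟨x₀, hx₀⟩⟩
  -- On the empty open set every rational function qualifies; uniqueness statements therefore ask
  -- for a point.
  · exact ⟨0, fun x => hV.elim x⟩
  obtain ⟨d, A, B, W, hA, hB, hxW, hf⟩ := f.2 ⟨x₀, hx₀⟩
  have hB0 := (hf ⟨x₀, hx₀⟩ hxW).1
  refine ⟨toRat k A / toRat k B, fun x => ?_⟩
  obtain ⟨d', A', B', W', hA', hB', hxW', hf'⟩ := f.2 x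
  obtain ⟨hx, hfx⟩ := hf' x hxW'
  refine ⟨d', A', B', hA', hB', hx, ?_, hfx⟩
  rw [div_eq_div_iff (toRat_ne_zero hB hB0) (toRat_ne_zero hB' hx), ← map_mul, ← map_mul,
    toRat_apply, toRat_apply]
  congr 1
  rw [← sub_eq_zero]
  obtain ⟨h, hh, hV⟩ := exists_dense (V := V ⊓ W) ⟨hx₀, hxW⟩
  obtain ⟨h', hh', hV'⟩ := exists_dense (V := V ⊓ W') ⟨x.2, hxW'⟩
  refine matPoly_eq_zero (mul_ne_zero hh hh') fun g hg => ?_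
  rw [map_mul] at hg
  have h1 := hV g (left_ne_zero_of_mul hg)
  have h2 := hV' g (right_ne_zero_of_mul hg)
  obtain ⟨s, t, hs, ht, hst⟩ := evalAt_pt g
  obtain ⟨e1, e2⟩ := hf ⟨pt g, h1.1⟩ h1.2
  obtain ⟨e1', e2'⟩ := hf' ⟨pt g, h1.1⟩ h2.2
  rw [e2] at e2'
  dsimp only at e1 e2' e1'
  rw [hst d B hB] at e1
  rw [hst d' B' hB'] at e1'
  rw [hst d A hA, hst d B hB, hst d' A' hA', hst d' B' hB',
    mul_div_mul_left _ _ (left_ne_zero_of_mul e1), mul_div_mul_left _ _ (left_ne_zero_of_mul e1'),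
    div_eq_div_iff (right_ne_zero_of_mul e1) (right_ne_zero_of_mul e1')] at e2'
  rw [map_sub, map_mul, map_mul, map_mul, map_mul, e2', sub_self]

/-- `Represents` tests values only at invertible matrices; by density these also determine the germs
at the boundary. -/
theorem represents_iff {V : Opens (Gbar k)} {f : regular V} {r : RatFun k} {x : Gbar k}
    (hx : x ∈ V) : Represents r f ↔ IsGermOn f r := by
  refine ⟨fun h => ?_, IsGermOn.represents⟩
  obtain ⟨s, hs⟩ := exists_isGermOn f
  rwa [h.eq hx hs.represents]

/-- The rational function giving a regular function. -/
def germ {V : Opens (Gbar k)} (f : regular V) : RatFun k := (exists_isGermOn f).choose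

theorem isGermOn_germ {V : Opens (Gbar k)} (f : regular V) : IsGermOn f (germ f) :=
  (exists_isGermOn f).choose_spec

end Germ

/-! ### Sheaf endomorphisms from operators on rational functions -/

section OfOperator

variable {k : Type*} [Field k] [Infinite k]

/-- The endomorphism of `𝒪_U` given by an operator on rational functions which preserves the local
rings at the points of `U`. -/
def SheafEnd.ofOperator (U : Opens (Gbar k)) (M : Module.End k (RatFun k))
    (hM : ∀ x ∈ U, ∀ r ∈ localRing x, M r ∈ localRing x) : SheafEnd U where
  app V hV :=
    { toFun := fun f => ⟨fun x => germValue x.1 (M (germ f)), mem_regular_of_isGerm fun x =>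
        isGerm_germValue (hM x.1 (hV x.2) _ ((isGermOn_germ f).mem_localRing x.2))⟩
      map_add' := fun f g => by
        refine Subtype.ext (funext fun x => ?_)
        have h := (isGermOn_germ (f + g)).unique x.2 ((isGermOn_germ f).add (isGermOn_germ g))
        have hf := isGerm_germValue (hM x.1 (hV x.2) _ ((isGermOn_germ f).mem_localRing x.2))
        have hg := isGerm_germValue (hM x.1 (hV x.2) _ ((isGermOn_germ g).mem_localRing x.2))
        have hfg := isGerm_germValue
          (hM x.1 (hV x.2) _ ((isGermOn_germ (f + g)).mem_localRing x.2))
        refine hfg.unique ?_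
        rw [h, map_add]
        exact hf.add hg
      map_smul' := fun c f => by
        refine Subtype.ext (funext fun x => ?_)
        have h := (isGermOn_germ (c • f)).unique x.2 ((isGermOn_germ f).smul c)
        have hf := isGerm_germValue (hM x.1 (hV x.2) _ ((isGermOn_germ f).mem_localRing x.2))
        have hcf := isGerm_germValue (hM x.1 (hV x.2) _ ((isGermOn_germ (c • f)).mem_localRing x.2))
        refine hcf.unique ?_
        rw [h, map_smul]
        exact hf.smul c }
  naturality V W hV hWV f := by
    refine Subtype.ext (funext fun x => ?_)
    have h := (isGermOn_germ (res hWV f)).unique x.2 ((isGermOn_germ f).res hWV)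
    change germValue x.1 (M (germ f)) = germValue x.1 (M (germ (res hWV f)))
    rw [h]

variable {U : Opens (Gbar k)} {M : Module.End k (RatFun k)}
  {hM : ∀ x ∈ U, ∀ r ∈ localRing x, M r ∈ localRing x}

theorem isGermOn_ofOperator {V : Opens (Gbar k)} (hV : V ≤ U) {f : regular V} {r : RatFun k}
    (h : IsGermOn f r) : IsGermOn ((SheafEnd.ofOperator U M hM).app V hV f) (M r) := by
  intro x
  have hr := (isGermOn_germ f).unique x.2 h
  rw [← hr]
  exact isGerm_germValue (hM x.1 (hV x.2) _ ((isGermOn_germ f).mem_localRing x.2))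

theorem SheafEnd.ofOperator_isDerivation
    (hd : ∀ r s, M (r * s) = r * M s + s * M r) : (SheafEnd.ofOperator U M hM).IsDerivation := by
  intro V hV f g
  have hf := isGermOn_germ f
  have hg := isGermOn_germ g
  refine (isGermOn_ofOperator hV (hf.mul hg)).eq ?_
  rw [hd]
  exact (hf.mul (isGermOn_ofOperator hV hg)).add (hg.mul (isGermOn_ofOperator hV hf))

/-- An endomorphism given by an operator of order `≤ 2` is a differential operator of order
`≤ 2`. -/
theorem SheafEnd.ofOperator_isDiffOp_two
    (h2 : ∀ r s t, M (r * s * t) = r * M (s * t) + s * M (r * t) + t * M (r * s)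
      - r * s * M t - r * t * M s - s * t * M r) :
    SheafEnd.IsDiffOp 2 U (SheafEnd.ofOperator U M hM) := by
  intro V hV a W hW b
  have ha := (isGermOn_germ a).res hW
  have hb := isGermOn_germ b
  have hWU : W ≤ U := hW.trans hV
  let D := SheafEnd.ofOperator U M hM
  have hD : ∀ {V : Opens (Gbar k)} (hV : V ≤ U) {f : regular V} {r : RatFun k},
      IsGermOn f r → IsGermOn (D.app V hV f) (M r) := fun hV _ _ h => isGermOn_ofOperator hV h
  -- Taking r = s = t = 1 in `h2` forces M 1 = 0, so the double commutator is multiplication by its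
  -- value at 1, namely M(ab) - a M(b) - b M(a).
  refine ⟨D.app W hWU (res hW a * b) - res hW a * D.app W hWU b - b * D.app W hWU (res hW a), ?_⟩
  ext W' hW' : 3
  refine LinearMap.ext fun f => ?_
  have hf := isGermOn_germ f
  have hc := (((hD hWU (ha.mul hb)).sub
    (ha.mul (hD hWU hb))).sub (hb.mul (hD hWU ha))).res hW'
  have hR := hc.mul hf
  have ha' := ha.res hW'
  have hb' := hb.res hW'
  have hWU' : W' ≤ U := hW'.trans hWU
  have hL := ((hD hWU' (ha'.mul (hb'.mul hf))).sub
    (ha'.mul (hD hWU' (hb'.mul hf)))).sub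
    (hb'.mul ((hD hWU' (ha'.mul hf)).sub
    (ha'.mul (hD hWU' hf))))
  have key := h2 (germ a) (germ b) (germ f)
  rw [mul_assoc (germ a) (germ b) (germ f)] at key
  rw [key] at hL
  refine IsGermOn.eq hL ?_
  convert hR using 1
  · rfl
  · ring

theorem SheafEnd.ofOperator_givenBy {hM : ∀ x ∈ (⊤ : Opens (Gbar k)), ∀ r ∈ localRing x,
    M r ∈ localRing x} : GivenBy (SheafEnd.ofOperator ⊤ M hM) M := by
  intro V f r h
  rcases isEmpty_or_nonempty V with hV | ⟨⟨x, hx⟩⟩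
  · exact IsGermOn.represents fun x => hV.elim x
  · exact (isGermOn_ofOperator le_top ((represents_iff hx).1 h)).represents

end OfOperator

/-! ### Generators of the local rings -/

section Generators

variable {k : Type*} [Field k]

/-- The local ring at `x` is generated by `S`, by means of the operations of a `k`-algebra and
the inversion of units. -/
def GeneratesLocalRing (x : Gbar k) (S : Set (RatFun k)) : Prop :=
  S ⊆ localRing x ∧ ∀ B : Subalgebra k (RatFun k), S ⊆ B →
    (∀ r ∈ B, r ∈ localRing x → r⁻¹ ∈ localRing x → r⁻¹ ∈ B) → localRing x ≤ B

/-- Elements with regular image form a subalgebra by the Leibniz rule, closed under inverting units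
by D(r⁻¹) = -r⁻² D(r). -/
theorem GeneratesLocalRing.derivation_mem {x : Gbar k} {S : Set (RatFun k)}
    (hS : GeneratesLocalRing x S) (D : Derivation k (RatFun k) (RatFun k))
    (h : ∀ s ∈ S, D s ∈ localRing x) : ∀ r ∈ localRing x, D r ∈ localRing x := by
  let B : Subalgebra k (RatFun k) :=
    { carrier := {r | r ∈ localRing x ∧ D r ∈ localRing x}
      mul_mem' := fun {r s} hr hs => ⟨mul_mem hr.1 hs.1, by
        rw [D.leibniz, smul_eq_mul, smul_eq_mul]
        exact add_mem (mul_mem hr.1 hs.2) (mul_mem hs.1 hr.2)⟩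
      add_mem' := fun {r s} hr hs => ⟨add_mem hr.1 hs.1, by
        rw [map_add]
        exact add_mem hr.2 hs.2⟩
      algebraMap_mem' := fun c => ⟨(localRing x).algebraMap_mem c, by
        rw [D.map_algebraMap]
        exact zero_mem _⟩ }
  have hB : localRing x ≤ B := hS.2 B (fun s hs => ⟨hS.1 hs, h s hs⟩) fun r hr _ hr' => ⟨hr', by
    rw [D.leibniz_inv, smul_eq_mul]
    exact mul_mem (neg_mem (pow_mem hr' 2)) hr.2⟩
  exact fun r hr => (hB hr).2

/-- Neither D nor E has to preserve the local ring. The failure of D ∘ E to satisfy the Leibniz rule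
is the symmetric symbol D(r)E(s) + E(r)D(s), a derivation in each argument, so its regularity passes
from generators to the whole ring one argument at a time. -/
theorem GeneratesLocalRing.comp_mem {x : Gbar k} {S : Set (RatFun k)}
    (hS : GeneratesLocalRing x S) (D E : Derivation k (RatFun k) (RatFun k))
    (h : ∀ s ∈ S, ∀ t ∈ S, D s * E t + E s * D t ∈ localRing x)
    (h' : ∀ s ∈ S, D (E s) ∈ localRing x) : ∀ r ∈ localRing x, D (E r) ∈ localRing x := by
  have h1 : ∀ s ∈ S, ∀ r ∈ localRing x, D s * E r + E s * D r ∈ localRing x := fun s hs =>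
    hS.derivation_mem (D s • E + E s • D) (h s hs)
  have h2 : ∀ r ∈ localRing x, ∀ s ∈ localRing x, D r * E s + E r * D s ∈ localRing x :=
    fun r hr => hS.derivation_mem (D r • E + E r • D) fun s hs => by
      have := h1 s hs r hr
      rw [add_comm, mul_comm (D s), mul_comm (E s)] at this
      exact this
  have h3 : ∀ r s, D (E (r * s)) = r * D (E s) + s * D (E r) + (D r * E s + E r * D s) := by
    intro r s
    simp only [Derivation.leibniz, map_add, smul_eq_mul]
    ring
  let B : Subalgebra k (RatFun k) :=
    { carrier := {r | r ∈ localRing x ∧ D (E r) ∈ localRing x}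
      mul_mem' := fun {r s} hr hs => ⟨mul_mem hr.1 hs.1, by
        rw [h3]
        exact add_mem (add_mem (mul_mem hr.1 hs.2) (mul_mem hs.1 hr.2)) (h2 r hr.1 s hs.1)⟩
      add_mem' := fun {r s} hr hs => ⟨add_mem hr.1 hs.1, by
        rw [map_add, map_add]
        exact add_mem hr.2 hs.2⟩
      algebraMap_mem' := fun c => ⟨(localRing x).algebraMap_mem c, by
        rw [E.map_algebraMap, map_zero]
        exact zero_mem _⟩ }
  have hB : localRing x ≤ B := hS.2 B (fun s hs => ⟨hS.1 hs, h' s hs⟩) fun r hr _ hr' => ⟨hr', by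
    rcases eq_or_ne r 0 with rfl | hr0
    · rw [inv_zero, map_zero, map_zero]
      exact zero_mem _
    -- Expanding D(E(r r⁻¹)) = 0 expresses D(E(r⁻¹)) through regular terms.
    have h4 := h3 r r⁻¹
    rw [mul_inv_cancel₀ hr0, E.map_one_eq_zero, map_zero] at h4
    have h5 : D (E r⁻¹) = -(r⁻¹ * (r⁻¹ * D (E r) + (D r * E r⁻¹ + E r * D r⁻¹))) := by
      have : r * D (E r⁻¹) = -(r⁻¹ * D (E r) + (D r * E r⁻¹ + E r * D r⁻¹)) := by
        linear_combination -h4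
      rw [← mul_neg, ← this, inv_mul_cancel_left₀ hr0]
    rw [h5]
    exact neg_mem (mul_mem hr' (add_mem (mul_mem hr' hr.2) (h2 r hr.1 _ hr')))⟩
  exact fun r hr => (hB hr).2

/-! ### The bigraded pieces -/

/-- The rational functions given by bihomogeneous polynomials of bidegree `d`. -/
def bigraded (k : Type*) [Field k] (d : ℕ × ℕ) : Submodule k (RatFun k) :=
  (weightedHomogeneousSubmodule k
    (Sum.elim (fun _ => (1, 0)) (fun _ => (0, 1)) : BiIdx → ℕ × ℕ) d).map (toRat k).toLinearMap

theorem mul_mem_bigraded {d e : ℕ × ℕ} {r s : RatFun k} (hr : r ∈ bigraded k d)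
    (hs : s ∈ bigraded k e) : r * s ∈ bigraded k (d + e) := by
  obtain ⟨F, hF, rfl⟩ := hr
  obtain ⟨G, hG, rfl⟩ := hs
  exact ⟨F * G, IsBihom.mul hF hG, map_mul (toRat k) _ _⟩

theorem algebraMap_mem_bigraded (c : k) : algebraMap k (RatFun k) c ∈ bigraded k 0 :=
  ⟨C c, isWeightedHomogeneous_C _ _, (toRat k).commutes c⟩

theorem one_mem_bigraded : (1 : RatFun k) ∈ bigraded k 0 := by
  have := algebraMap_mem_bigraded (1 : k)
  rwa [map_one] at this

variable (k) in
/-- The matrix entry `g i j` as a rational function. -/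
def gR (p : Fin 3 × Fin 3) : RatFun k := toRat k (X (Sum.inl p))

variable (k) in
/-- The entry `i j` of the matrix of cofactors of `g` as a rational function. -/
def cR (p : Fin 3 × Fin 3) : RatFun k := toRat k (X (Sum.inr p))

theorem gR_mem (p : Fin 3 × Fin 3) : gR k p ∈ bigraded k (1, 0) :=
  ⟨_, isBihom_gX p.1 p.2, rfl⟩

theorem cR_mem (p : Fin 3 × Fin 3) : cR k p ∈ bigraded k (0, 1) :=
  ⟨_, isBihom_gX' p.1 p.2, rfl⟩

theorem gR_eq (p : Fin 3 × Fin 3) : gR k p = algebraMap (MatPoly k) (RatFun k) (X p) := by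
  simp [gR, toRat_apply, toMat]

theorem isBihom_pow_mul_pow (p q : Fin 3 × Fin 3) (d : ℕ × ℕ) :
    IsBihom (X (Sum.inl p) ^ d.1 * X (Sum.inr q) ^ d.2 : MvPolynomial BiIdx k) d := by
  have h : IsBihom (X (Sum.inl p) ^ d.1 * X (Sum.inr q) ^ d.2 : MvPolynomial BiIdx k)
      (d.1 • (1, 0) + d.2 • (0, 1)) :=
    ((isBihom_gX (k := k) p.1 p.2).pow d.1).mul ((isBihom_gX' (k := k) q.1 q.2).pow d.2)
  rwa [show d.1 • ((1, 0) : ℕ × ℕ) + d.2 • ((0, 1) : ℕ × ℕ) = d by ext <;> simp] at h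

variable {x : Gbar k} {p q : Fin 3 × Fin 3}

/-- The regularity test for the explicit computations. One rational function may lie in several
bigraded pieces, since the entries of g and Com g are not independent, and the piece is chosen to
match the denominator. -/
theorem bigraded_div_mem (hp : x.1.evalAt (X (Sum.inl p)) ≠ 0)
    (hq : x.1.evalAt (X (Sum.inr q)) ≠ 0) {d e : ℕ} {r : RatFun k} (hr : r ∈ bigraded k (d, e)) :
    r / (gR k p ^ d * cR k q ^ e) ∈ localRing x := by
  obtain ⟨F, hF, rfl⟩ := hr
  refine ⟨_, (d, e), F, X (Sum.inl p) ^ d * X (Sum.inr q) ^ e, hF,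
    isBihom_pow_mul_pow p q (d, e), ?_, ?_, rfl⟩
  · simp only [BiProj.evalAt, map_mul, map_pow] at *
    exact mul_ne_zero (pow_ne_zero _ hp) (pow_ne_zero _ hq)
  · simp [gR, cR]

theorem gR_ne_zero (p : Fin 3 × Fin 3) : gR k p ≠ 0 := by
  rw [gR_eq]
  exact algebraMap_ne_zero (X_ne_zero p)

theorem cR_ne_zero_of_evalAt (hq : x.1.evalAt (X (Sum.inr q)) ≠ 0) : cR k q ≠ 0 :=
  toRat_ne_zero (isBihom_gX' q.1 q.2) hq

theorem toRat_eq_mul_aeval (hp : gR k p ≠ 0) (hq : cR k q ≠ 0) {d : ℕ × ℕ}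
    {F : MvPolynomial BiIdx k} (hF : IsBihom F d) : toRat k F = gR k p ^ d.1 * cR k q ^ d.2 *
      aeval (Sum.elim (fun i => gR k i / gR k p) (fun i => cR k i / cR k q)) F := by
  rw [← hF.aeval_smul]
  have : toRat k = aeval (Sum.elim (fun i => gR k p * (gR k i / gR k p))
      (fun i => cR k q * (cR k i / cR k q))) := by
    ext i
    rcases i with i | i
    · rw [aeval_X, Sum.elim_inl, mul_div_cancel₀ _ hp, gR]
    · rw [aeval_X, Sum.elim_inr, mul_div_cancel₀ _ hq, cR]
  exact DFunLike.congr_fun this F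

variable (k) in
/-- The affine coordinates `g i j / g p` and `g' i j / g' q`. -/
def ratios (p q : Fin 3 × Fin 3) : Set (RatFun k) :=
  Set.range (fun i => gR k i / gR k p) ∪ Set.range (fun i => cR k i / cR k q)

theorem aeval_mem_of_mem {σ A : Type*} [CommRing A] [Algebra k A] {B : Subalgebra k A} {u : σ → A}
    (hu : ∀ i, u i ∈ B) (F : MvPolynomial σ k) : aeval u F ∈ B := by
  have h : aeval u F ∈ (aeval u : MvPolynomial σ k →ₐ[k] A).range := ⟨F, rfl⟩
  rw [← Algebra.adjoin_range_eq_range_aeval] at h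
  exact Algebra.adjoin_le (Set.range_subset_iff.2 hu) h

/-- Dehomogenisation: dividing numerator and denominator of bidegree d by g_p^d.1 c_q^d.2 turns both
into polynomials in the ratios, and the denominator into a unit. -/
theorem generatesLocalRing_ratios (hp : x.1.evalAt (X (Sum.inl p)) ≠ 0)
    (hq : x.1.evalAt (X (Sum.inr q)) ≠ 0) : GeneratesLocalRing x (ratios k p q) := by
  refine ⟨?_, fun B hB hinv => ?_⟩
  · rintro _ (⟨i, rfl⟩ | ⟨i, rfl⟩)
    · simpa using bigraded_div_mem hp hq (gR_mem i)
    · simpa using bigraded_div_mem hp hq (cR_mem i)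
  have hB' : ∀ F : MvPolynomial BiIdx k,
      aeval (Sum.elim (fun i => gR k i / gR k p) (fun i => cR k i / cR k q)) F ∈ B :=
    aeval_mem_of_mem (by
      rintro (i | i)
      · exact hB (Or.inl ⟨i, rfl⟩)
      · exact hB (Or.inr ⟨i, rfl⟩))
  have hgp := gR_ne_zero (k := k) p
  have hcq := cR_ne_zero_of_evalAt hq
  rintro _ ⟨_, d, A, A', hA, hA', hx, rfl, rfl⟩
  have h1 := toRat_eq_mul_aeval hgp hcq hA
  have h2 := toRat_eq_mul_aeval hgp hcq hA'
  have hpq : gR k p ^ d.1 * cR k q ^ d.2 ≠ 0 := mul_ne_zero (pow_ne_zero _ hgp) (pow_ne_zero _ hcq)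
  rw [h1, h2, mul_div_mul_left _ _ hpq, div_eq_mul_inv]
  refine mul_mem (hB' A) (hinv _ (hB' A') ?_ ?_)
  · have := bigraded_div_mem hp hq (d := d.1) (e := d.2) ⟨A', hA', rfl⟩
    change toRat k A' / _ ∈ _ at this
    rwa [h2, mul_div_cancel_left₀ _ hpq] at this
  · have : gR k p ^ d.1 * cR k q ^ d.2 / toRat k A' ∈ localRing x :=
      ⟨_, d, X (Sum.inl p) ^ d.1 * X (Sum.inr q) ^ d.2, A', isBihom_pow_mul_pow p q d, hA', hx,
        by simp [gR, cR], rfl⟩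
    rwa [h2, div_mul_cancel_left₀ hpq] at this

variable (x) in
theorem exists_evalAt_ne_zero : (∃ p, x.1.evalAt (X (Sum.inl p)) ≠ 0) ∧
    ∃ q, x.1.evalAt (X (Sum.inr q)) ≠ 0 := by
  constructor
  · by_contra! h
    refine x.1.1.rep_nonzero (Matrix.ext fun i j => ?_)
    simpa [BiProj.evalAt] using h (i, j)
  · by_contra! h
    refine x.1.2.rep_nonzero (Matrix.ext fun i j => ?_)
    simpa [BiProj.evalAt] using h (i, j)

theorem exists_isGermOn_of_mem {r : RatFun k} (hr : r ∈ localRing x) :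
    ∃ (W : Opens (Gbar k)) (f : regular W), x ∈ W ∧ IsGermOn f r := by
  obtain ⟨_, d, A, B, hA, hB, hx, rfl, rfl⟩ := hr
  exact ⟨⟨_, isOpen_ne_zero hB⟩, frac _ d A B hA hB fun y => y.2, hx, fun y =>
    ⟨d, A, B, hA, hB, y.2, rfl, rfl⟩⟩

end Generators

/-! ### The operator in matrix coordinates preserves the local rings -/

section MatrixOperator

variable {k : Type*} [Field k]

theorem cR_eq (i j : Fin 3) : cR k (i, j) =
    !![gR k (1, 1) * gR k (2, 2) - gR k (1, 2) * gR k (2, 1),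
      gR k (1, 2) * gR k (2, 0) - gR k (1, 0) * gR k (2, 2),
      gR k (1, 0) * gR k (2, 1) - gR k (1, 1) * gR k (2, 0);
      gR k (0, 2) * gR k (2, 1) - gR k (0, 1) * gR k (2, 2),
      gR k (0, 0) * gR k (2, 2) - gR k (0, 2) * gR k (2, 0),
      gR k (0, 1) * gR k (2, 0) - gR k (0, 0) * gR k (2, 1);
      gR k (0, 1) * gR k (1, 2) - gR k (0, 2) * gR k (1, 1),
      gR k (0, 2) * gR k (1, 0) - gR k (0, 0) * gR k (1, 2),
      gR k (0, 0) * gR k (1, 1) - gR k (0, 1) * gR k (1, 0)] i j := by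
  simp only [cR, toRat_apply, toMat, aeval_X, Sum.elim_inr, Matrix.adjugate_fin_three, gR_eq]
  fin_cases i <;> fin_cases j <;> simp <;> ring

variable (k) in
/-- The determinant as a rational function. -/
def detR : RatFun k := algebraMap (MatPoly k) (RatFun k) (genMat k).det

theorem detR_eq : detR k = gR k (0, 0) * cR k (0, 0) + gR k (0, 1) * cR k (0, 1) +
    gR k (0, 2) * cR k (0, 2) := by
  simp only [cR_eq, gR_eq, detR, Matrix.det_fin_three]
  simp
  ring

theorem minor_eq (i j : Fin 3) : minor (k := k) i j = (-1) ^ (i + j : ℕ) * cR k (i, j) := by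
  simp only [minor, cR_eq, Matrix.det_fin_two, gR_eq]
  fin_cases i <;> fin_cases j <;>
    simp [Matrix.mvPolynomialX, Fin.succAbove, Fin.lt_def] <;> ring

variable (k) in
/-- The vector field `∂/∂g i j`. -/
abbrev dR (p : Fin 3 × Fin 3) : Derivation k (RatFun k) (RatFun k) := extendDer (pderiv p)

theorem dR_gR (p q : Fin 3 × Fin 3) : dR k p (gR k q) = if q = p then 1 else 0 := by
  rw [gR_eq, extendDer_algebraMap, pderiv_X, Pi.single_apply]
  split_ifs <;> simp

variable (k) in
/-- The vector field `Δ₂₂ ∂₁₁ + Δ₁₁ ∂₂₂ + Δ₂₁ ∂₁₂ + Δ₁₂ ∂₂₁`. -/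
def minorField : Derivation k (RatFun k) (RatFun k) :=
  cR k (1, 1) • dR k (0, 0) + cR k (0, 0) • dR k (1, 1) - cR k (1, 0) • dR k (0, 1) -
    cR k (0, 1) • dR k (1, 0)

theorem matrixOperator_apply (r : RatFun k) :
    matrixOperator k r = dR k (0, 0) (minorField k r) := by
  simp [matrixOperator, minorField, pd, minor_eq, sub_eq_add_neg]

theorem dR_cR (i j : Fin 3) : dR k (0, 0) (cR k (i, j)) =
    !![0, 0, 0; 0, gR k (2, 2), -gR k (2, 1); 0, -gR k (1, 2), gR k (1, 1)] i j := by
  rw [cR_eq]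
  fin_cases i <;> fin_cases j <;> simp [dR_gR, Prod.ext_iff]

theorem dR_detR : dR k (0, 0) (detR k) = cR k (0, 0) := by
  simp [detR_eq, dR_gR, dR_cR, Prod.ext_iff]

/-- The nonzero entries are g₃₃ times those of the Schur complement of g₃₃: the field rescales that
complement and fixes the last row and column. -/
theorem minorField_gR (i j : Fin 3) : minorField k (gR k (i, j)) =
    !![cR k (1, 1), -cR k (1, 0), 0; -cR k (0, 1), cR k (0, 0), 0; 0, 0, 0] i j := by
  fin_cases i <;> fin_cases j <;> simp [minorField, dR_gR, Prod.ext_iff]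

/-- All cofactors are linear in the Schur complement S of g₃₃ except c₃₃, which has the additional
quadratic part det S = det/g₃₃. Scaling S at rate g₃₃ gives the formula. -/
theorem minorField_cR (p : Fin 3 × Fin 3) : minorField k (cR k p) =
    gR k (2, 2) * cR k p + algebraMap k _ (if p = (2, 2) then 1 else 0) * detR k := by
  obtain ⟨i, j⟩ := p
  rw [detR_eq]
  fin_cases i <;> fin_cases j <;> simp [cR_eq, minorField_gR] <;> ring

/-- Jacobi's identity: Com(Com g) = det(g)·g. -/
theorem detR_mul_gR (i j : Fin 3) : detR k * gR k (i, j) =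
    !![cR k (1, 1) * cR k (2, 2) - cR k (1, 2) * cR k (2, 1),
      cR k (1, 2) * cR k (2, 0) - cR k (1, 0) * cR k (2, 2),
      cR k (1, 0) * cR k (2, 1) - cR k (1, 1) * cR k (2, 0);
      cR k (0, 2) * cR k (2, 1) - cR k (0, 1) * cR k (2, 2),
      cR k (0, 0) * cR k (2, 2) - cR k (0, 2) * cR k (2, 0),
      cR k (0, 1) * cR k (2, 0) - cR k (0, 0) * cR k (2, 1);
      cR k (0, 1) * cR k (1, 2) - cR k (0, 2) * cR k (1, 1),
      cR k (0, 2) * cR k (1, 0) - cR k (0, 0) * cR k (1, 2),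
      cR k (0, 0) * cR k (1, 1) - cR k (0, 1) * cR k (1, 0)] i j := by
  rw [detR_eq]
  fin_cases i <;> fin_cases j <;> simp [cR_eq] <;> ring

theorem detR_mem : detR k ∈ bigraded k (1, 1) := by
  rw [detR_eq]
  exact add_mem (add_mem (mul_mem_bigraded (gR_mem _) (cR_mem _))
    (mul_mem_bigraded (gR_mem _) (cR_mem _))) (mul_mem_bigraded (gR_mem _) (cR_mem _))

theorem detR_mul_gR_mem (p : Fin 3 × Fin 3) : detR k * gR k p ∈ bigraded k (0, 2) := by
  have h (p q r s : Fin 3 × Fin 3) : cR k p * cR k q - cR k r * cR k s ∈ bigraded k (0, 2) :=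
    sub_mem (mul_mem_bigraded (cR_mem p) (cR_mem q)) (mul_mem_bigraded (cR_mem r) (cR_mem s))
  obtain ⟨i, j⟩ := p
  rw [detR_mul_gR]
  fin_cases i <;> fin_cases j <;> exact h _ _ _ _

theorem cR_mem_two (p : Fin 3 × Fin 3) : cR k p ∈ bigraded k (2, 0) := by
  have h (p q r s : Fin 3 × Fin 3) : gR k p * gR k q - gR k r * gR k s ∈ bigraded k (2, 0) :=
    sub_mem (mul_mem_bigraded (gR_mem p) (gR_mem q)) (mul_mem_bigraded (gR_mem r) (gR_mem s))
  obtain ⟨i, j⟩ := p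
  rw [cR_eq]
  fin_cases i <;> fin_cases j <;> exact h _ _ _ _

theorem dR_gR_mem (p q : Fin 3 × Fin 3) : dR k p (gR k q) ∈ bigraded k 0 := by
  rw [dR_gR]
  split_ifs
  · exact one_mem_bigraded
  · exact zero_mem _

theorem dR_cR_mem (p : Fin 3 × Fin 3) : dR k (0, 0) (cR k p) ∈ bigraded k (1, 0) := by
  obtain ⟨i, j⟩ := p
  rw [dR_cR]
  fin_cases i <;> fin_cases j <;>
    first | exact zero_mem _ | exact gR_mem _ | exact neg_mem (gR_mem _)

theorem detR_mul_dR_cR_mem (p : Fin 3 × Fin 3) :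
    detR k * dR k (0, 0) (cR k p) ∈ bigraded k (0, 2) := by
  obtain ⟨i, j⟩ := p
  rw [dR_cR]
  fin_cases i <;> fin_cases j <;> simp [detR_mul_gR_mem]

theorem minorField_gR_mem (p : Fin 3 × Fin 3) : minorField k (gR k p) ∈ bigraded k (0, 1) := by
  obtain ⟨i, j⟩ := p
  rw [minorField_gR]
  fin_cases i <;> fin_cases j <;>
    first | exact zero_mem _ | exact cR_mem _ | exact neg_mem (cR_mem _)

theorem minorField_gR_mem_two (p : Fin 3 × Fin 3) :
    minorField k (gR k p) ∈ bigraded k (2, 0) := by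
  obtain ⟨i, j⟩ := p
  rw [minorField_gR]
  fin_cases i <;> fin_cases j <;>
    first | exact zero_mem _ | exact cR_mem_two _ | exact neg_mem (cR_mem_two _)

theorem dR_minorField_gR_mem (p : Fin 3 × Fin 3) :
    dR k (0, 0) (minorField k (gR k p)) ∈ bigraded k (1, 0) := by
  obtain ⟨i, j⟩ := p
  rw [minorField_gR]
  fin_cases i <;> fin_cases j <;> simp [dR_cR, gR_mem]

end MatrixOperator

/-! ### Regularity of the symbol and of the values on generators -/

section Stability

variable {k : Type*} [Field k]

theorem derivation_div (D : Derivation k (RatFun k) (RatFun k)) (a b : RatFun k) :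
    D (a / b) = (b * D a - a * D b) / b ^ 2 := by
  rw [Derivation.leibniz_div]
  simp only [smul_eq_mul]
  ring

theorem dR_ratio_gR (p i : Fin 3 × Fin 3) : ∃ n ∈ bigraded k (1, 0),
    dR k (0, 0) (gR k i / gR k p) = n / gR k p ^ 2 :=
  ⟨_, sub_mem (mul_mem_bigraded (gR_mem p) (dR_gR_mem _ i))
    (mul_mem_bigraded (gR_mem i) (dR_gR_mem _ p)), derivation_div _ _ _⟩

/-- The same numerator is needed in two bidegrees, with cofactors read as linear in g' or as
quadratic in g: the former to pair with ratios of cofactors, the latter with ratios of entries. -/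
theorem minorField_ratio_gR (p i : Fin 3 × Fin 3) :
    ∃ n ∈ bigraded k (1, 1), n ∈ bigraded k (3, 0) ∧
      minorField k (gR k i / gR k p) = n / gR k p ^ 2 :=
  ⟨_, sub_mem (mul_mem_bigraded (gR_mem p) (minorField_gR_mem i))
    (mul_mem_bigraded (gR_mem i) (minorField_gR_mem p)),
    sub_mem (mul_mem_bigraded (gR_mem p) (minorField_gR_mem_two i))
    (mul_mem_bigraded (gR_mem i) (minorField_gR_mem_two p)), derivation_div _ _ _⟩

theorem dR_ratio_cR (q i : Fin 3 × Fin 3) : ∃ n ∈ bigraded k (1, 1),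
    detR k * n ∈ bigraded k (0, 3) ∧ dR k (0, 0) (cR k i / cR k q) = n / cR k q ^ 2 := by
  refine ⟨_, sub_mem (mul_mem_bigraded (dR_cR_mem i) (cR_mem q))
    (mul_mem_bigraded (dR_cR_mem q) (cR_mem i)), ?_, ?_⟩
  · rw [mul_sub, ← mul_assoc, ← mul_assoc]
    exact sub_mem (mul_mem_bigraded (detR_mul_dR_cR_mem i) (cR_mem q))
      (mul_mem_bigraded (detR_mul_dR_cR_mem q) (cR_mem i))
  · rw [derivation_div]
    ring

/-- The terms g₃₃c_p of `minorField_cR` cancel in the quotient rule. The surviving factor det is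
what moves the numerators of `dR_ratio_cR` into bidegree (0, 3). -/
theorem minorField_ratio_cR (q i : Fin 3 × Fin 3) :
    ∃ n ∈ bigraded k (0, 1), detR k * dR k (0, 0) n ∈ bigraded k (0, 2) ∧
      minorField k (cR k i / cR k q) = detR k * n / cR k q ^ 2 := by
  have h (c : k) (p : Fin 3 × Fin 3) : algebraMap k (RatFun k) c * cR k p ∈ bigraded k (0, 1) := by
    rw [← Algebra.smul_def]
    exact Submodule.smul_mem _ _ (cR_mem p)
  have h' (c : k) (p : Fin 3 × Fin 3) :
      detR k * (dR k (0, 0) (algebraMap k (RatFun k) c * cR k p)) ∈ bigraded k (0, 2) := by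
    rw [← Algebra.smul_def, Derivation.map_smul, mul_smul_comm]
    exact Submodule.smul_mem _ _ (detR_mul_dR_cR_mem p)
  refine ⟨_, sub_mem (h (if i = (2, 2) then 1 else 0) q) (h (if q = (2, 2) then 1 else 0) i), ?_,
    ?_⟩
  · rw [map_sub, mul_sub]
    exact sub_mem (h' _ _) (h' _ _)
  · rw [derivation_div, minorField_cR, minorField_cR]
    ring

variable {x : Gbar k} {p q : Fin 3 × Fin 3}

theorem symbol_gR_gR_mem (hp : x.1.evalAt (X (Sum.inl p)) ≠ 0)
    (hq : x.1.evalAt (X (Sum.inr q)) ≠ 0) (i j : Fin 3 × Fin 3) :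
    dR k (0, 0) (gR k i / gR k p) * minorField k (gR k j / gR k p) ∈ localRing x := by
  obtain ⟨n, hn, h⟩ := dR_ratio_gR (k := k) p i
  obtain ⟨m, -, hm, h'⟩ := minorField_ratio_gR (k := k) p j
  have := bigraded_div_mem hp hq (d := 4) (e := 0) (mul_mem_bigraded hn hm)
  convert this using 1
  rw [h, h']
  field_simp

theorem symbol_gR_cR_mem (hp : x.1.evalAt (X (Sum.inl p)) ≠ 0)
    (hq : x.1.evalAt (X (Sum.inr q)) ≠ 0) (i j : Fin 3 × Fin 3) :
    dR k (0, 0) (gR k i / gR k p) * minorField k (cR k j / cR k q) ∈ localRing x := by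
  obtain ⟨n, hn, h⟩ := dR_ratio_gR (k := k) p i
  obtain ⟨m, hm, -, h'⟩ := minorField_ratio_cR (k := k) q j
  have := bigraded_div_mem hp hq (d := 2) (e := 2)
    (mul_mem_bigraded hn (mul_mem_bigraded detR_mem hm))
  convert this using 1
  rw [h, h', div_mul_div_comm]

theorem symbol_cR_gR_mem (hp : x.1.evalAt (X (Sum.inl p)) ≠ 0)
    (hq : x.1.evalAt (X (Sum.inr q)) ≠ 0) (i j : Fin 3 × Fin 3) :
    dR k (0, 0) (cR k i / cR k q) * minorField k (gR k j / gR k p) ∈ localRing x := by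
  obtain ⟨n, hn, -, h⟩ := dR_ratio_cR (k := k) q i
  obtain ⟨m, hm, -, h'⟩ := minorField_ratio_gR (k := k) p j
  have := bigraded_div_mem hp hq (d := 2) (e := 2) (mul_mem_bigraded hm hn)
  convert this using 1
  rw [h, h', div_mul_div_comm, mul_comm n, mul_comm (cR k q ^ 2)]

theorem symbol_cR_cR_mem (hp : x.1.evalAt (X (Sum.inl p)) ≠ 0)
    (hq : x.1.evalAt (X (Sum.inr q)) ≠ 0) (i j : Fin 3 × Fin 3) :
    dR k (0, 0) (cR k i / cR k q) * minorField k (cR k j / cR k q) ∈ localRing x := by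
  obtain ⟨n, -, hn, h⟩ := dR_ratio_cR (k := k) q i
  obtain ⟨m, hm, -, h'⟩ := minorField_ratio_cR (k := k) q j
  have := bigraded_div_mem hp hq (d := 0) (e := 4) (mul_mem_bigraded hn hm)
  convert this using 1
  rw [h, h', div_mul_div_comm, pow_zero, one_mul]
  ring_nf

theorem dR_minorField_ratio_gR_mem (hp : x.1.evalAt (X (Sum.inl p)) ≠ 0)
    (hq : x.1.evalAt (X (Sum.inr q)) ≠ 0) (i : Fin 3 × Fin 3) :
    dR k (0, 0) (minorField k (gR k i / gR k p)) ∈ localRing x := by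
  have hgp := gR_ne_zero (k := k) p
  have ht (a b : Fin 3 × Fin 3) : gR k p * (dR k (0, 0) (gR k a) * minorField k (gR k b)) ∈
      bigraded k (3, 0) :=
    mul_mem_bigraded (gR_mem p) (mul_mem_bigraded (dR_gR_mem _ a) (minorField_gR_mem_two b))
  have ht' (a b : Fin 3 × Fin 3) : gR k p * (gR k a * dR k (0, 0) (minorField k (gR k b))) ∈
      bigraded k (3, 0) :=
    mul_mem_bigraded (gR_mem p) (mul_mem_bigraded (gR_mem a) (dR_minorField_gR_mem b))
  have hs : gR k p * minorField k (gR k i) - gR k i * minorField k (gR k p) ∈ bigraded k (3, 0) :=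
    sub_mem (mul_mem_bigraded (gR_mem p) (minorField_gR_mem_two i))
    (mul_mem_bigraded (gR_mem i) (minorField_gR_mem_two p))
  have hs' := mul_mem_bigraded hs (dR_gR_mem (0, 0) p)
  -- `hs'` is subtracted twice because the denominator being differentiated is the square of g_p.
  have := bigraded_div_mem hp hq (d := 3) (e := 0) (sub_mem (sub_mem (add_mem
    (sub_mem (ht p i) (ht i p)) (sub_mem (ht' p i) (ht' i p))) hs') hs')
  convert this using 1
  rw [derivation_div, derivation_div]
  simp only [map_sub, Derivation.leibniz, Derivation.leibniz_pow, smul_eq_mul, nsmul_eq_mul]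
  field_simp
  push_cast
  ring

theorem dR_minorField_ratio_cR_mem (hp : x.1.evalAt (X (Sum.inl p)) ≠ 0)
    (hq : x.1.evalAt (X (Sum.inr q)) ≠ 0) (i : Fin 3 × Fin 3) :
    dR k (0, 0) (minorField k (cR k i / cR k q)) ∈ localRing x := by
  have hcq := cR_ne_zero_of_evalAt hq
  obtain ⟨n, hn, hn', h⟩ := minorField_ratio_cR (k := k) q i
  -- `h1` and `h2` are the two terms of c_q ∂(det·n), as ∂ det = c₁₁; `h3` is det·n·∂c_q, counted
  -- twice because of the denominator c_q².
  have h1 := mul_mem_bigraded (cR_mem q) (mul_mem_bigraded (cR_mem (k := k) (0, 0)) hn)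
  have h2 := mul_mem_bigraded (cR_mem q) hn'
  have h3 := mul_mem_bigraded (detR_mul_dR_cR_mem q) hn
  have := bigraded_div_mem hp hq (d := 0) (e := 3) (sub_mem (sub_mem (add_mem h1 h2) h3) h3)
  convert this using 1
  rw [h, derivation_div]
  simp only [Derivation.leibniz, Derivation.leibniz_pow, smul_eq_mul, nsmul_eq_mul, dR_detR]
  field_simp
  push_cast
  ring

variable (x) in
theorem matrixOperator_mem : ∀ r ∈ localRing x, matrixOperator k r ∈ localRing x := by
  obtain ⟨⟨p, hp⟩, q, hq⟩ := exists_evalAt_ne_zero x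
  intro r hr
  rw [matrixOperator_apply]
  refine (generatesLocalRing_ratios hp hq).comp_mem _ _ ?_ ?_ r hr
  · rintro _ (⟨i, rfl⟩ | ⟨i, rfl⟩) _ (⟨j, rfl⟩ | ⟨j, rfl⟩) <;>
      rw [mul_comm (minorField k _) (dR k _ _)] <;> refine add_mem ?_ ?_
    · exact symbol_gR_gR_mem hp hq _ _
    · exact symbol_gR_gR_mem hp hq _ _
    · exact symbol_gR_cR_mem hp hq _ _
    · exact symbol_cR_gR_mem hp hq _ _
    · exact symbol_cR_gR_mem hp hq _ _
    · exact symbol_gR_cR_mem hp hq _ _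
    · exact symbol_cR_cR_mem hp hq _ _
    · exact symbol_cR_cR_mem hp hq _ _
  · rintro _ (⟨i, rfl⟩ | ⟨i, rfl⟩)
    · exact dR_minorField_ratio_gR_mem hp hq i
    · exact dR_minorField_ratio_cR_mem hp hq i

end Stability

/-! ### The coordinate vector fields on the big cell -/

section CoordinateFields

variable {k : Type*} [Field k]

variable (k) in
/-- The coordinates on the big cell as rational functions of the matrix entries. -/
def coordR : Coord → RatFun k
  | .α₁ => (cR k (0, 0) * cR k (1, 1) - cR k (0, 1) * cR k (1, 0)) / (cR k (0, 0) * cR k (0, 0))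
  | .α₂ => (gR k (1, 1) * gR k (2, 2) - gR k (1, 2) * gR k (2, 1)) / (gR k (2, 2) * gR k (2, 2))
  | .U₁₂ => -cR k (1, 0) / cR k (0, 0)
  | .U₂₁ => -cR k (0, 1) / cR k (0, 0)
  | .U₁₃ => gR k (0, 2) / gR k (2, 2)
  | .U₂₃ => gR k (1, 2) / gR k (2, 2)
  | .U₃₁ => gR k (2, 0) / gR k (2, 2)
  | .U₃₂ => gR k (2, 1) / gR k (2, 2)

theorem isGermOn_coord (c : Coord) : IsGermOn (coord c) (coordR k c) := by
  intro y
  have h0 := y.2.1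
  have h1 := y.2.2
  simp only [Set.mem_ofPred_eq] at h0 h1
  cases c
  case α₁ =>
    refine ⟨_, _, _, ((isBihom_gX' 0 0).mul (isBihom_gX' 1 1)).sub
      ((isBihom_gX' 0 1).mul (isBihom_gX' 1 0)), (isBihom_gX' 0 0).mul (isBihom_gX' 0 0),
      ?_, ?_, rfl⟩
    · rw [evalAt_mul]
      exact mul_ne_zero h1 h1
    · simp only [map_mul, map_sub]
      rfl
  case α₂ =>
    refine ⟨_, _, _, ((isBihom_gX 1 1).mul (isBihom_gX 2 2)).sub
      ((isBihom_gX 1 2).mul (isBihom_gX 2 1)), (isBihom_gX 2 2).mul (isBihom_gX 2 2),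
      ?_, ?_, rfl⟩
    · rw [evalAt_mul]
      exact mul_ne_zero h0 h0
    · simp only [map_mul, map_sub]
      rfl
  case U₁₂ =>
    exact ⟨_, _, _, (isBihom_gX' 1 0).neg, isBihom_gX' 0 0, h1, by simp only [map_neg]; rfl, rfl⟩
  case U₂₁ =>
    exact ⟨_, _, _, (isBihom_gX' 0 1).neg, isBihom_gX' 0 0, h1, by simp only [map_neg]; rfl, rfl⟩
  case U₁₃ => exact ⟨_, _, _, isBihom_gX 0 2, isBihom_gX 2 2, h0, rfl, rfl⟩
  case U₂₃ => exact ⟨_, _, _, isBihom_gX 1 2, isBihom_gX 2 2, h0, rfl, rfl⟩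
  case U₃₁ => exact ⟨_, _, _, isBihom_gX 2 0, isBihom_gX 2 2, h0, rfl, rfl⟩
  case U₃₂ => exact ⟨_, _, _, isBihom_gX 2 1, isBihom_gX 2 2, h0, rfl, rfl⟩

theorem cR_zero_zero_ne_zero : cR k (0, 0) ≠ 0 := by
  intro h
  have h1 := congrArg (evalMat (1 : Mat k)) (toRat_eq_zero.1 h)
  rw [evalMat_toMat, map_zero, aeval_X, Sum.elim_inr] at h1
  simp [comatrix] at h1

theorem gR_one_one_eq : gR k (1, 1) =
    (cR k (0, 0) + gR k (1, 2) * gR k (2, 1)) / gR k (2, 2) := by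
  rw [cR_eq, eq_div_iff (gR_ne_zero _)]
  simp

variable (k) in
/-- The coordinate vector fields, normalised so that they kill `g₃₃`. -/
def partialField : Coord → Derivation k (RatFun k) (RatFun k)
  | .α₁ => (cR k (0, 0) / gR k (2, 2)) • dR k (0, 0)
  | .α₂ => (gR k (2, 2) / cR k (0, 0)) • minorField k
  | .U₁₂ => (cR k (0, 0) / gR k (2, 2)) • dR k (0, 1) - (cR k (0, 1) / gR k (2, 2)) • dR k (0, 0)
  | .U₂₁ => (cR k (0, 0) / gR k (2, 2)) • dR k (1, 0) - (cR k (1, 0) / gR k (2, 2)) • dR k (0, 0)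
  | .U₁₃ => gR k (2, 0) • dR k (0, 0) + gR k (2, 1) • dR k (0, 1) + gR k (2, 2) • dR k (0, 2)
  | .U₂₃ => gR k (2, 0) • dR k (1, 0) + gR k (2, 1) • dR k (1, 1) + gR k (2, 2) • dR k (1, 2)
  | .U₃₁ => gR k (0, 2) • dR k (0, 0) + gR k (1, 2) • dR k (1, 0) + gR k (2, 2) • dR k (2, 0)
  | .U₃₂ => gR k (0, 2) • dR k (0, 1) + gR k (1, 2) • dR k (1, 1) + gR k (2, 2) • dR k (2, 1)

/-- The coefficients of the two fields are mutually inverse, and ∂/∂g₁₁ kills them because neither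
g₃₃ nor c₁₁ involves g₁₁. -/
theorem matrixOperator_eq_comp (r : RatFun k) :
    matrixOperator k r = partialField k .α₁ (partialField k .α₂ r) := by
  have h0 := gR_ne_zero (k := k) (2, 2)
  have h1 := cR_zero_zero_ne_zero (k := k)
  have h2 : dR k (0, 0) (gR k (2, 2) / cR k (0, 0)) = 0 := by
    simp [derivation_div, dR_gR, dR_cR, Prod.ext_iff]
  rw [matrixOperator_apply]
  simp only [partialField, Derivation.smul_apply, smul_eq_mul, Derivation.leibniz, h2]
  field_simp
  ring

/-- On the big cell all ratios to g₃₃ and c₁₁ are polynomials in the eight coordinates. -/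
theorem generatesLocalRing_coordR {x : Gbar k} (hx : x ∈ bigCell k) :
    GeneratesLocalRing x (Set.range (coordR k)) := by
  refine ⟨?_, fun B hB hinv => ?_⟩
  · rintro _ ⟨c, rfl⟩
    exact (isGermOn_coord c).mem_localRing hx
  refine (generatesLocalRing_ratios (p := (2, 2)) (q := (0, 0)) hx.1 hx.2).2 B ?_ hinv
  have hc : ∀ c, coordR k c ∈ B := fun c => hB ⟨c, rfl⟩
  -- The side condition keeps c₁₁ unexpanded, so that it remains an atom which `field_simp` can
  -- clear; g₂₂ is eliminated through it.
  have hne (i j : Fin 3) (_ : ¬(i = 0 ∧ j = 0)) := cR_eq (k := k) i j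
  have h0 := gR_ne_zero (k := k) (2, 2)
  have h1 := cR_zero_zero_ne_zero (k := k)
  let F : Coord → MvPolynomial Coord k := X
  have key : ∀ r : RatFun k, (∃ P : MvPolynomial Coord k, aeval (coordR k) P = r) → r ∈ B := by
    rintro _ ⟨P, rfl⟩
    exact aeval_mem_of_mem hc P
  rintro _ (⟨⟨i, j⟩, rfl⟩ | ⟨⟨i, j⟩, rfl⟩)
  -- The witnesses are the entries of u diag(α₁α₂, α₂, 1) u', and in the second case those of Com(u)
  -- diag(1, α₁, α₁α₂) Com(u').
  · refine key _ ⟨!![F .α₁ * F .α₂ + F .α₂ * F .U₁₂ * F .U₂₁ + F .U₁₃ * F .U₃₁,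
      F .α₂ * F .U₁₂ + F .U₁₃ * F .U₃₂, F .U₁₃;
      F .α₂ * F .U₂₁ + F .U₂₃ * F .U₃₁, F .α₂ + F .U₂₃ * F .U₃₂, F .U₂₃;
      F .U₃₁, F .U₃₂, 1] i j, ?_⟩
    fin_cases i <;> fin_cases j <;>
      simp [F, coordR, h0, hne, gR_one_one_eq] <;> field_simp <;> ring
  · refine key _ ⟨!![1, -F .U₂₁, F .U₂₁ * F .U₃₂ - F .U₃₁;
      -F .U₁₂, F .U₁₂ * F .U₂₁ + F .α₁,
      -F .U₁₂ * (F .U₂₁ * F .U₃₂ - F .U₃₁) - F .α₁ * F .U₃₂;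
      F .U₁₂ * F .U₂₃ - F .U₁₃,
      -(F .U₁₂ * F .U₂₃ - F .U₁₃) * F .U₂₁ - F .α₁ * F .U₂₃,
      (F .U₁₂ * F .U₂₃ - F .U₁₃) * (F .U₂₁ * F .U₃₂ - F .U₃₁) + F .α₁ * F .U₂₃ * F .U₃₂ +
        F .α₁ * F .α₂] i j, ?_⟩
    fin_cases i <;> fin_cases j <;>
      simp [F, coordR, h1, hne, gR_one_one_eq] <;> field_simp <;> ring

theorem dR_cR_zero_zero (p : Fin 3 × Fin 3) : dR k p (cR k (0, 0)) =
    gR k (1, 1) * (if (2, 2) = p then 1 else 0) + gR k (2, 2) * (if (1, 1) = p then 1 else 0) -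
      (gR k (1, 2) * (if (2, 1) = p then 1 else 0) +
        gR k (2, 1) * (if (1, 2) = p then 1 else 0)) := by
  rw [cR_eq]
  simp [dR_gR]

set_option maxHeartbeats 1000000 in
open Classical in
theorem partialField_coordR (c e : Coord) :
    partialField k c (coordR k e) = if e = c then 1 else 0 := by
  have h0 := gR_ne_zero (k := k) (2, 2)
  have h1 := cR_zero_zero_ne_zero (k := k)
  have hne (i j : Fin 3) (_ : ¬(i = 0 ∧ j = 0)) := cR_eq (k := k) i j
  cases c
  case α₂ =>
    cases e <;> simp [partialField, coordR, derivation_div, minorField_gR, minorField_cR,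
      detR_eq, h1] <;> (try simp [hne, gR_one_one_eq, h0]) <;> (try field_simp) <;> ring1
  all_goals
    cases e <;> simp [partialField, coordR, derivation_div, dR_gR, dR_cR_zero_zero, hne, h0, h1] <;>
      (try field_simp) <;> first | ring1 | exact Or.inr (by ring1)

end CoordinateFields

/-! ### Existence and uniqueness of the coordinate derivations -/

section Partials

variable {k : Type*} [Field k]

theorem SheafEnd.IsDerivation.app_one {U V : Opens (Gbar k)} {D : SheafEnd U}
    (hD : D.IsDerivation) (hV : V ≤ U) : D.app V hV 1 = 0 := by
  have h := hD V hV 1 1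
  simp only [one_mul] at h
  simpa using h

theorem matrixOperator_one : matrixOperator k 1 = 0 := by
  rw [matrixOperator_apply, Derivation.map_one_eq_zero, map_zero]

theorem matrixOperator_α₁ : matrixOperator k (coordR k .α₁) = 0 := by
  rw [matrixOperator_eq_comp, partialField_coordR, if_neg (by simp), map_zero]

theorem matrixOperator_α₂ : matrixOperator k (coordR k .α₂) = 0 := by
  rw [matrixOperator_eq_comp, partialField_coordR, if_pos rfl, Derivation.map_one_eq_zero]

theorem matrixOperator_α₁_mul_α₂ : matrixOperator k (coordR k .α₁ * coordR k .α₂) = 1 := by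
  rw [matrixOperator_eq_comp, Derivation.leibniz, partialField_coordR, partialField_coordR,
    if_pos rfl, if_neg (by simp), smul_zero, add_zero, smul_eq_mul, mul_one, partialField_coordR,
    if_pos rfl]

variable [Infinite k]

/-- A derivation of the structure sheaf of the big cell is determined by its values on the
coordinates. -/
theorem derivation_eq_of_coord {D E : SheafEnd (bigCell k)} (hD : D.IsDerivation)
    (hE : E.IsDerivation)
    (h : ∀ c, D.app (bigCell k) le_rfl (coord c) = E.app (bigCell k) le_rfl (coord c)) :
    D = E := by
  have hres {W W' : Opens (Gbar k)} (hW : W ≤ bigCell k) (hW' : W' ≤ W) {f : regular W}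
      (hf : D.app W hW f = E.app W hW f) :
      D.app W' (hW'.trans hW) (res hW' f) = E.app W' (hW'.trans hW) (res hW' f) := by
    rw [← D.naturality W W' hW hW', ← E.naturality W W' hW hW', hf]
  have key : ∀ x ∈ bigCell k, ∀ r ∈ localRing x, ∃ (W : Opens (Gbar k)) (hW : W ≤ bigCell k)
      (f : regular W), x ∈ W ∧ IsGermOn f r ∧ D.app W hW f = E.app W hW f := by
    intro x hx
    -- The germs on which D and E agree near x form a subalgebra; being closed under inverting
    -- units, it is the whole local ring.
    let B : Subalgebra k (RatFun k) :=
      { carrier := {r | ∃ (W : Opens (Gbar k)) (hW : W ≤ bigCell k) (f : regular W), x ∈ W ∧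
          IsGermOn f r ∧ D.app W hW f = E.app W hW f}
        mul_mem' := by
          rintro r s ⟨W, hW, f, hxW, hf, hDf⟩ ⟨W', hW', f', hxW', hf', hDf'⟩
          refine ⟨W ⊓ W', inf_le_left.trans hW, res inf_le_left f * res inf_le_right f',
            ⟨hxW, hxW'⟩, (hf.res _).mul (hf'.res _), ?_⟩
          rw [hD, hE, hres hW inf_le_left hDf, hres hW' inf_le_right hDf']
        add_mem' := by
          rintro r s ⟨W, hW, f, hxW, hf, hDf⟩ ⟨W', hW', f', hxW', hf', hDf'⟩
          refine ⟨W ⊓ W', inf_le_left.trans hW, res inf_le_left f + res inf_le_right f',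
            ⟨hxW, hxW'⟩, (hf.res _).add (hf'.res _), ?_⟩
          rw [map_add, map_add, hres hW inf_le_left hDf, hres hW' inf_le_right hDf']
        algebraMap_mem' := fun c => by
          refine ⟨bigCell k, le_rfl, c • 1, hx, ?_, ?_⟩
          · rw [Algebra.algebraMap_eq_smul_one]
            exact (IsGermOn.one _).smul c
          · rw [map_smul, map_smul, hD.app_one, hE.app_one] }
    refine (generatesLocalRing_coordR hx).2 B ?_ ?_
    · rintro _ ⟨c, rfl⟩
      exact ⟨bigCell k, le_rfl, coord c, hx, isGermOn_coord c, h c⟩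
    · rintro r hr - hr'
      rcases eq_or_ne r 0 with rfl | hr0
      · rwa [inv_zero]
      obtain ⟨W, hW, f, hxW, hf, hDf⟩ := hr
      obtain ⟨W', f', hxW', hf'⟩ := exists_isGermOn_of_mem hr'
      have hW'' : W ⊓ W' ≤ bigCell k := inf_le_left.trans hW
      refine ⟨W ⊓ W', hW'', res inf_le_right f', ⟨hxW, hxW'⟩, hf'.res _, ?_⟩
      -- From f f' = 1 the Leibniz rule determines the image of f' from that of f, after cancelling
      -- the unit f.
      have hm : res inf_le_left f * res inf_le_right f' = (1 : regular (W ⊓ W')) := by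
        refine ((hf.res _).mul (hf'.res _)).eq ?_
        rw [mul_inv_cancel₀ hr0]
        exact IsGermOn.one _
      have h1 := hD (W ⊓ W') hW'' (res inf_le_left f) (res inf_le_right f')
      have h2 := hE (W ⊓ W') hW'' (res inf_le_left f) (res inf_le_right f')
      have h3 := hres hW inf_le_left (W' := W ⊓ W') hDf
      rw [hm, hD.app_one] at h1
      rw [hm, hE.app_one, ← h3] at h2
      have h4 := h1.symm.trans h2
      have h5 := add_right_cancel h4
      have h6 := congrArg (fun t => res inf_le_right f' * t) h5
      simp only [← mul_assoc] at h6
      rwa [mul_comm (res inf_le_right f'), hm, one_mul, one_mul] at h6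
  ext V hV : 3
  refine LinearMap.ext fun f => Subtype.ext (_root_.funext fun x => ?_)
  obtain ⟨r, hr⟩ := exists_isGermOn f
  obtain ⟨W, hW, f', hxW, hf', hDf'⟩ := key x.1 (hV x.2) r (hr.mem_localRing x.2)
  have hx' : x.1 ∈ V ⊓ W := ⟨x.2, hxW⟩
  have hff' : res inf_le_left f = (res inf_le_right f' : regular (V ⊓ W)) :=
    (hr.res _).eq (hf'.res _)
  have h1 := D.naturality V (V ⊓ W) hV inf_le_left f
  have h2 := E.naturality V (V ⊓ W) hV inf_le_left f
  rw [hff'] at h1 h2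
  rw [hres hW inf_le_right hDf', ← h2] at h1
  exact congrFun (congrArg Subtype.val h1) ⟨x.1, hx'⟩

variable (k) in
/-- The coordinate vector field `∂_c` on the big cell. -/
def partialEnd (c : Coord) : SheafEnd (bigCell k) :=
  SheafEnd.ofOperator (bigCell k) (partialField k c).toLinearMap fun _ hx =>
    (generatesLocalRing_coordR hx).derivation_mem (partialField k c) (by
      rintro _ ⟨e, rfl⟩
      rw [partialField_coordR]
      split_ifs
      exacts [one_mem _, zero_mem _])

theorem isGermOn_partialEnd (c : Coord) {V : Opens (Gbar k)} (hV : V ≤ bigCell k) {f : regular V}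
    {r : RatFun k} (h : IsGermOn f r) :
    IsGermOn ((partialEnd k c).app V hV f) (partialField k c r) :=
  isGermOn_ofOperator hV h

theorem isPartial_partialEnd (c : Coord) : IsPartial c (partialEnd k c) := by
  refine ⟨SheafEnd.ofOperator_isDerivation fun r s => (partialField k c).leibniz r s, fun e => ?_⟩
  have h := isGermOn_partialEnd c le_rfl (isGermOn_coord (k := k) e)
  rw [partialField_coordR] at h
  refine h.eq ?_
  split_ifs
  · exact IsGermOn.one _
  · have := (IsGermOn.one (bigCell k)).sub (IsGermOn.one (bigCell k))
    rwa [sub_self, sub_self] at this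

theorem IsPartial.eq {c : Coord} {D E : SheafEnd (bigCell k)} (hD : IsPartial c D)
    (hE : IsPartial c E) : D = E :=
  derivation_eq_of_coord hD.1 hE.1 fun e => by rw [hD.2, hE.2]

/-! ### The global operator -/

theorem exists_mem_inf_bigCell {V : Opens (Gbar k)} {x : Gbar k} (hx : x ∈ V) :
    ∃ y, y ∈ V ⊓ bigCell k := by
  have hP : toMat k (gX k 2 2 * gX' k 0 0) ≠ 0 := by
    rw [← toRat_eq_zero.ne, map_mul]
    exact mul_ne_zero (gR_ne_zero (2, 2)) cR_zero_zero_ne_zero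
  obtain ⟨g, hgV, hg⟩ := exists_pt_mem hx hP
  obtain ⟨s, t, hs, ht, hst⟩ := evalAt_pt g
  refine ⟨pt g, hgV, ?_⟩
  have h := hst _ _ ((isBihom_gX (k := k) 2 2).mul (isBihom_gX' 0 0))
  have h0 : (pt g).1.evalAt (gX k 2 2 * gX' k 0 0) ≠ 0 := by
    rw [h]
    exact mul_ne_zero (mul_ne_zero (pow_ne_zero _ hs) (pow_ne_zero _ ht)) hg
  rw [evalAt_mul] at h0
  exact ⟨left_ne_zero_of_mul h0, right_ne_zero_of_mul h0⟩

variable (k) in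
theorem exists_mem_bigCell : ∃ y, y ∈ bigCell k := by
  obtain ⟨y, -, hy⟩ := exists_mem_inf_bigCell (V := ⊤) (x := pt (1 : GL (Fin 3) k)) trivial
  exact ⟨y, hy⟩

/-- An endomorphism of the structure sheaf is determined by its restriction to the big cell. -/
theorem eq_of_restrict_bigCell {D E : SheafEnd (⊤ : Opens (Gbar k))}
    (h : D.restrict (le_top : bigCell k ≤ ⊤) = E.restrict le_top) : D = E := by
  ext V hV : 3
  refine LinearMap.ext fun f => ?_
  rcases isEmpty_or_nonempty V with hV' | ⟨⟨x, hx⟩⟩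
  · exact Subtype.ext (_root_.funext fun x => hV'.elim x)
  -- The big cell meets every nonempty V, so the two images have equal restrictions on a nonempty
  -- open set and hence the same rational function.
  obtain ⟨y, hy⟩ := exists_mem_inf_bigCell hx
  obtain ⟨r, hr⟩ := exists_isGermOn (D.app V hV f)
  obtain ⟨s, hs⟩ := exists_isGermOn (E.app V hV f)
  have h1 : (D.restrict (le_top : bigCell k ≤ ⊤)).app (V ⊓ bigCell k) inf_le_right
      (res inf_le_left f) = (E.restrict (le_top : bigCell k ≤ ⊤)).app (V ⊓ bigCell k) inf_le_right
      (res inf_le_left f) := by rw [h]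
  have h2 : res inf_le_left (D.app V hV f) =
      (res inf_le_left (E.app V hV f) : regular (V ⊓ bigCell k)) := by
    rw [D.naturality, E.naturality]
    exact h1
  have hr' := hr.res (W := V ⊓ bigCell k) inf_le_left
  rw [h2] at hr'
  rw [hr'.unique hy (hs.res _)] at hr
  exact hr.eq hs

variable (k) in
/-- The global differential operator extending `∂_{α₁} ∂_{α₂}`. -/
def globalOperator : SheafEnd (⊤ : Opens (Gbar k)) :=
  SheafEnd.ofOperator ⊤ (matrixOperator k) fun x _ => matrixOperator_mem x

theorem globalOperator_restrict : (globalOperator k).restrict (le_top : bigCell k ≤ ⊤) =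
    (partialEnd k .α₁).comp (partialEnd k .α₂) := by
  ext V hV : 3
  refine LinearMap.ext fun f => ?_
  obtain ⟨r, hr⟩ := exists_isGermOn f
  have h1 : IsGermOn ((globalOperator k).app V le_top f) (matrixOperator k r) :=
    isGermOn_ofOperator le_top hr
  have h2 := isGermOn_partialEnd .α₁ hV (isGermOn_partialEnd .α₂ hV hr)
  rw [matrixOperator_eq_comp] at h1
  exact h1.eq h2

theorem globalOperator_isDiffOp : SheafEnd.IsDiffOp 2 ⊤ (globalOperator k) := by
  refine SheafEnd.ofOperator_isDiffOp_two fun r s t => ?_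
  simp only [matrixOperator_apply, Derivation.leibniz, map_add, smul_eq_mul]
  ring

/-- If the order were ≤ 1, the commutator with α₁ would be multiplication by some c. Its value at 1
gives c = 0, while its value at α₂ is 1. -/
theorem globalOperator_not_isDiffOp : ¬SheafEnd.IsDiffOp 1 ⊤ (globalOperator k) := by
  intro h
  obtain ⟨c, hc⟩ := h (bigCell k) le_top (coord .α₁)
  obtain ⟨y, hy⟩ := exists_mem_bigCell k
  obtain ⟨r, hr⟩ := exists_isGermOn c
  have key {f : regular (bigCell k)} {s : RatFun k} (hs : IsGermOn f s) :
      matrixOperator k (coordR k .α₁ * s) - coordR k .α₁ * matrixOperator k s = r * s := by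
    have h1 := congrArg (fun D : SheafEnd (bigCell k) => D.app (bigCell k) le_rfl f) hc
    have h2 : IsGermOn ((globalOperator k).app (bigCell k) le_top (coord .α₁ * f) -
        coord .α₁ * (globalOperator k).app (bigCell k) le_top f) _ :=
      IsGermOn.sub (isGermOn_ofOperator le_top ((isGermOn_coord .α₁).mul hs))
        ((isGermOn_coord .α₁).mul (isGermOn_ofOperator le_top hs))
    have h3 : (globalOperator k).app (bigCell k) le_top (coord .α₁ * f) -
        coord .α₁ * (globalOperator k).app (bigCell k) le_top f = c * f := h1
    rw [h3] at h2
    exact h2.unique hy (hr.mul hs)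
  have h1 := key (IsGermOn.one (bigCell k))
  have h2 := key (isGermOn_coord .α₂)
  rw [mul_one, mul_one, matrixOperator_one, matrixOperator_α₁, mul_zero, sub_zero] at h1
  rw [matrixOperator_α₁_mul_α₂, matrixOperator_α₂, ← h1, mul_zero, sub_zero, zero_mul] at h2
  exact one_ne_zero h2

end Partials

/-! ### The action of the enveloping algebra preserves the boundary -/

section Enveloping

variable {k : Type*} [Field k]

theorem universalEnvelopingAlgebra_map_mem {R L : Type*} [CommRing R] [LieRing L]
    [LieAlgebra R L] {A : Type*} [Ring A] [Algebra R A]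
    (φ : UniversalEnvelopingAlgebra R L →ₐ[R] A) (S : Subalgebra R A)
    (h : ∀ x, φ (UniversalEnvelopingAlgebra.mkAlgHom R L (TensorAlgebra.ι R x)) ∈ S)
    (u : UniversalEnvelopingAlgebra R L) : φ u ∈ S := by
  obtain ⟨t, rfl⟩ : ∃ t, UniversalEnvelopingAlgebra.mkAlgHom R L t = u :=
    Quotient.exists_rep u
  induction t using TensorAlgebra.induction with
  | algebraMap r => simp only [AlgHom.commutes, S.algebraMap_mem]
  | ι x => exact h x
  | mul a b ha hb =>
    rw [map_mul, map_mul]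
    exact mul_mem ha hb
  | add a b ha hb =>
    rw [map_add, map_add]
    exact add_mem ha hb

/-- A point of the boundary of the big cell. -/
def boundaryMatrix (k : Type*) [Field k] : Mat k := Matrix.diagonal ![0, 1, 1]

variable (k) in
/-- The rational functions which are regular at `diag(0, 1, 1)` and vanish on `det = 0`. -/
def boundaryIdeal : Submodule k (RatFun k) where
  carrier := {r | ∃ P Q : MatPoly k, evalMat (boundaryMatrix k) Q ≠ 0 ∧
    r = detR k * (algebraMap _ _ P / algebraMap _ _ Q)}
  zero_mem' := ⟨0, 1, by simp, by simp⟩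
  add_mem' := by
    rintro _ _ ⟨P, Q, hQ, rfl⟩ ⟨P', Q', hQ', rfl⟩
    have h0 : Q ≠ 0 := fun h => hQ (by rw [h, map_zero])
    have h0' : Q' ≠ 0 := fun h => hQ' (by rw [h, map_zero])
    refine ⟨P * Q' + Q * P', Q * Q', ?_, ?_⟩
    · rw [map_mul]
      exact mul_ne_zero hQ hQ'
    · rw [map_add, map_mul, map_mul, map_mul,
        ← div_add_div _ _ (algebraMap_ne_zero h0) (algebraMap_ne_zero h0'), mul_add]
  smul_mem' := by
    rintro c _ ⟨P, Q, hQ, rfl⟩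
    refine ⟨c • P, Q, hQ, ?_⟩
    rw [Algebra.smul_def, Algebra.smul_def, map_mul,
      ← IsScalarTower.algebraMap_apply k (MatPoly k) (RatFun k)]
    ring

/-- Otherwise the denominator Q would be a multiple of det and vanish at diag(0, 1, 1). -/
theorem one_notMem_boundaryIdeal : (1 : RatFun k) ∉ boundaryIdeal k := by
  rintro ⟨P, Q, hQ, h⟩
  have h0 : Q ≠ 0 := fun h => hQ (by rw [h, map_zero])
  rw [detR, mul_div_assoc', eq_div_iff (algebraMap_ne_zero h0), one_mul, ← map_mul] at h
  have h1 := congrArg (evalMat (boundaryMatrix k)) (FaithfulSMul.algebraMap_injective _ _ h)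
  rw [map_mul, evalMat_det] at h1
  refine hQ (h1.trans ?_)
  simp [boundaryMatrix, Fin.prod_univ_three]

/-- By Jacobi's identity α₁ = g₃₃ det/c₁₁², while α₂ = c₁₁/g₃₃². The product is det/(g₃₃c₁₁), and
g₃₃ = c₁₁ = 1 at diag(0, 1, 1). -/
theorem α₁_mul_α₂_mem_boundaryIdeal : coordR k .α₁ * coordR k .α₂ ∈ boundaryIdeal k := by
  have h0 := gR_ne_zero (k := k) (2, 2)
  have h1 := cR_zero_zero_ne_zero (k := k)
  refine ⟨1, toMat k (gX k 2 2 * gX' k 0 0), ?_, ?_⟩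
  · rw [evalMat_toMat]
    simp [gX, gX', boundaryMatrix, comatrix, Matrix.adjugate_fin_three, Matrix.diagonal]
  · rw [← toRat_apply, map_mul, map_one]
    change _ = detR k * (1 / (gR k (2, 2) * cR k (0, 0)))
    have h2 := detR_mul_gR (k := k) 2 2
    have h3 := cR_eq (k := k) 0 0
    simp only [Matrix.of_apply, Matrix.cons_val', Matrix.cons_val] at h2 h3
    rw [coordR, coordR, ← h2, ← h3]
    field_simp

/-- Along -Xg + gY the determinant changes at the rate (tr Y - tr X) det, and both traces vanish. -/
theorem vectorField_detR (Z : Lie3 k × Lie3 k) : vectorField Z (detR k) = 0 := by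
  have h1 : Matrix.trace Z.1.1 = 0 := Z.1.2
  have h2 : Matrix.trace Z.2.1 = 0 := Z.2.2
  have h : vectorField Z (detR k) = detR k *
      algebraMap (MatPoly k) (RatFun k) (C (Matrix.trace Z.2.1 - Matrix.trace Z.1.1)) := by
    simp only [detR, Matrix.det_fin_three, Matrix.mvPolynomialX_apply, Matrix.trace,
      Matrix.diag, Fin.sum_univ_three, map_add, map_sub, map_mul, Derivation.leibniz,
      vectorField_X, smul_eq_mul, map_neg]
    ring
  rw [h, h1, h2, sub_zero, C_0, map_zero, mul_zero]

theorem vectorField_algebraMap (Z : Lie3 k × Lie3 k) (P : MatPoly k) :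
    ∃ P', vectorField Z (algebraMap _ _ P) = algebraMap (MatPoly k) (RatFun k) P' :=
  ⟨_, extendDer_algebraMap _ _⟩

/-- The point diag(0, 1, 1) need not be fixed by the action: the field kills det, preserves
polynomials, and the quotient rule only squares the denominator. -/
theorem vectorField_mem_boundaryIdeal (Z : Lie3 k × Lie3 k) {r : RatFun k}
    (hr : r ∈ boundaryIdeal k) : vectorField Z r ∈ boundaryIdeal k := by
  obtain ⟨P, Q, hQ, rfl⟩ := hr
  obtain ⟨P', hP'⟩ := vectorField_algebraMap Z P
  obtain ⟨Q', hQ'⟩ := vectorField_algebraMap Z Q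
  refine ⟨Q * P' - P * Q', Q ^ 2, ?_, ?_⟩
  · rw [map_pow]
    exact pow_ne_zero 2 hQ
  · rw [Derivation.leibniz, vectorField_detR, smul_zero, add_zero, derivation_div, hP', hQ',
      smul_eq_mul, map_sub, map_mul, map_mul, map_pow]

theorem envelopingAction_mem_boundaryIdeal (u : UniversalEnvelopingAlgebra k (Lie3 k × Lie3 k)) :
    ∀ r ∈ boundaryIdeal k, envelopingAction k u r ∈ boundaryIdeal k := by
  let S : Subalgebra k (Module.End k (RatFun k)) :=
    { carrier := {T | ∀ r ∈ boundaryIdeal k, T r ∈ boundaryIdeal k}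
      mul_mem' := fun {T T'} hT hT' r hr => hT _ (hT' r hr)
      add_mem' := fun {T T'} hT hT' r hr => add_mem (hT r hr) (hT' r hr)
      algebraMap_mem' := fun c r hr => Submodule.smul_mem _ c hr }
  refine universalEnvelopingAlgebra_map_mem (envelopingAction k) S (fun Z r hr => ?_) u
  rw [envelopingAction, UniversalEnvelopingAlgebra.lift_ι_apply']
  exact vectorField_mem_boundaryIdeal Z hr

end Enveloping

end WonderfulPGL3

end

/-! ### The main theorem -/

open WonderfulPGL3
theorem mainTheorem2 (k : Type*) [Field k] [IsAlgClosed k] [CharZero k] :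
    (∀ c : Coord, ∃! D : SheafEnd (bigCell k), IsPartial c D) ∧
    ∀ D₁ D₂ : SheafEnd (bigCell k), IsPartial .α₁ D₁ → IsPartial .α₂ D₂ →
      ∃ D₀ : SheafEnd (⊤ : TopologicalSpace.Opens (Gbar k)),
        D₀.restrict le_top = D₁.comp D₂ ∧
        (∀ D : SheafEnd (⊤ : TopologicalSpace.Opens (Gbar k)),
          D.restrict le_top = D₁.comp D₂ → D = D₀) ∧
        SheafEnd.IsDiffOp 2 ⊤ D₀ ∧ ¬ SheafEnd.IsDiffOp 1 ⊤ D₀ ∧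
        GivenBy D₀ (matrixOperator k) ∧
        ¬ ∃ u : UniversalEnvelopingAlgebra k (Lie3 k × Lie3 k),
          GivenBy D₀ (envelopingAction k u) := by
  have : Infinite k := IsAlgClosed.instInfinite
  refine ⟨fun c => ⟨partialEnd k c, isPartial_partialEnd c, fun D hD =>
    hD.eq (isPartial_partialEnd c)⟩, fun D₁ D₂ h₁ h₂ => ?_⟩
  obtain rfl := h₁.eq (isPartial_partialEnd _)
  obtain rfl := h₂.eq (isPartial_partialEnd _)
  refine ⟨globalOperator k, globalOperator_restrict, fun D hD =>
    eq_of_restrict_bigCell (hD.trans globalOperator_restrict.symm), globalOperator_isDiffOp,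
    globalOperator_not_isDiffOp, SheafEnd.ofOperator_givenBy, ?_⟩
  rintro ⟨u, hu⟩
  obtain ⟨y, hy⟩ := exists_mem_bigCell k
  have hα := ((isGermOn_coord (k := k) .α₁).mul (isGermOn_coord .α₂)).represents
  have h : GivenBy (globalOperator k) (matrixOperator k) := SheafEnd.ofOperator_givenBy
  -- Both operators represent the same function D₀(α₁α₂) on the nonempty big cell, so they agree on
  -- α₁α₂; this single value gives the contradiction.
  have he := (hu _ _ _ hα).eq hy (h _ _ _ hα)
  rw [matrixOperator_α₁_mul_α₂] at he
  have hm := envelopingAction_mem_boundaryIdeal u _ α₁_mul_α₂_mem_boundaryIdeal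
  rw [he] at hm
  exact one_notMem_boundaryIdeal hm
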